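/- **Setting.** Let $S=\mathbb C[x_1,\dots,x_n,p_1,\dots,p_l]$, graded by $\mathbb Z^r\times 2\mathbb Z$ (toric degree and $R$-degree): each variable has an arbitrary toric degree in $\mathbb Z^r$, the $x_i$ have $R$-degree $0$ and the $p_a$ have $R$-degree $2$. Let $W=\sum_a p_a f_a(x)\neq 0$, where $f_a\in\mathbb C[x_1,\dots,x_n]$ is homogeneous of toric degree opposite to that of $p_a$, so that $W$ has toric degree $0$ and $R$-degree $2$. Put $S'=S/(W)$. Write $(v)$ and $\{m\}$ for shifts of the toric grading and of the $R$-grading. *Matrix factorizations.* $\mathrm{DGr}\,S(W)$ is the triangulated category whose objects are graded matrix factorizations $\bar P=(u_1:P_1\rightleftarrows P_0:u_0)$, where $P_0,P_1$ are graded free $S$-modules of finite rank, $u_1$ has degree $0$, $u_0$ has toric degree $0$ and $R$-degree $2$, and $u_0u_1=u_1u_0=W\cdot\mathbf 1$; its morphisms are homotopy classes of degree-$0$ morphisms, its shift is $\bar P[1]=(P_0\rightleftarrows P_1\{2\})$, and its distinguished triangles are those isomorphic to mapping cone triangles. $K(\mathrm{DGr}\,S(W))$ is the free abelian group on its objects modulo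 $[a]-[b]+[c]=0$ for every distinguished triangle $a\to b\to c\to a[1]$. *Representatives.* Let $\mathbf D(\mathrm{gr}\text{-}S')$ be the bounded derived category of finitely generated graded $S'$-modules, and $\mathfrak{Perf}(S')$ the subcategory of complexes quasi-isomorphic to a finite length complex of finitely generated graded free modules. An object $M$ of $\mathbf D(\mathrm{gr}\text{-}S')$ *represents* a matrix factorization $a=\bar P$ if $M$ and $\operatorname{coker}(u_1:P_1\to P_0)$ (in degree $0$) are isomorphic in $\mathbf D(\mathrm{gr}\text{-}S')/\mathfrak{Perf}(S')$, by a roof $M\leftarrow Z\to\operatorname{coker}(u_1)$ of bounded complexes whose two cones are perfect. *The class $k$.* Put $k(S'(v)\{m\})=s^v\sigma^{-m}$, where $s^v=s_1^{v_1}\cdots s_r^{v_r}$. Let $F\to M$ be a resolution by a bounded-above complex of graded free $S'$-modules of finite rank in which, for all $v,m$, only finitely many $F^i$ have a summand $S'(v)\{m\}$. Let $k(F)=\sum_i(-1)^i k(F^i)\in\mathbb Z[[s_1^{\pm1},\dots,s_r^{\pm1},\sigma^{\pm1}]]$ (the group of two-sided formal series). **Theorem.** There is a unique group homomorphism $$\kappa: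 K(\mathrm{DGr}\,S(W))\to\mathbb Z[s_1^{\pm1},\dots,s_r^{\pm1}]$$ such that the following holds for every matrix factorization $a$ and every $M$ in $\mathbf D(\mathrm{gr}\text{-}S')$ representing $a$. Resolutions $F\to M$ as above exist, and they all have the same class $k(F)=:k(M)$. There are Laurent polynomials $f,g\in\mathbb Z[s_1^{\pm1},\dots,s_r^{\pm1},\sigma^{\pm1}]$ with $$k(M)=f\,(1+\sigma^2+\sigma^4+\cdots)+g=\frac{f}{1-\sigma^2}+g ,$$ and for all such $f,g$ one has $$\kappa([a])=\frac1{\pi i}\oint_\gamma\Bigl(\frac{f}{1-\sigma^2}+g\Bigr)d\sigma=f|_{\sigma=1}.$$ Here the integral is taken coefficientwise in $s$, and $\gamma$ is any circle of radius $\varepsilon\in(0,1)$ around $\sigma=1$, run through clockwise. -/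

import Mathlib

open CategoryTheory

noncomputable section

/-! ### The model: charges, superpotential, the rings `S` and `S' = S/(W)` -/

/-- Charges and polynomials of a gauged linear sigma model with coordinates `x_1, …, x_n` (of
`R`-charge `0`) and `p_1, …, p_l` (of `R`-charge `2`), gauge group of rank `r`, and
superpotential `W = ∑ p_a f_a(x)`. -/
structure SigmaModel (r n l : ℕ) where
  /-- the toric charges of the `x_i` -/
  chargeX : Fin n → (Fin r → ℤ)
  /-- the toric charges of the `p_a` -/
  chargeP : Fin l → (Fin r → ℤ)
  /-- the polynomials `f_a` in the variables `x_i` -/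
  f : Fin l → MvPolynomial (Fin n) ℂ
  /-- gauge invariance of `W`: each `f_a` is homogeneous, of toric degree opposite to `p_a` -/
  homogeneous : ∀ a, MvPolynomial.IsWeightedHomogeneous chargeX (f a) (-chargeP a)

/-- The grading group `ℤ^r × 2ℤ` (toric degree, `R`-degree). The second component of
`(v, m) : Deg r` is half of the `R`-degree, i.e. `(v, m)` stands for toric degree `v` and
`R`-degree `2m`. -/
abbrev Deg (r : ℕ) : Type := (Fin r → ℤ) × ℤ

namespace SigmaModel

variable {r n l : ℕ} (X : SigmaModel r n l)

/-- The homogeneous coordinate ring `S = ℂ[x_1, …, x_n, p_1, …, p_l]`. -/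
abbrev S (_X : SigmaModel r n l) : Type := MvPolynomial (Fin n ⊕ Fin l) ℂ

/-- The degrees of the variables: `x_i` has `R`-degree `0` and `p_a` has `R`-degree `2`. -/
def weight : Fin n ⊕ Fin l → Deg r :=
  Sum.elim (fun i => (X.chargeX i, 0)) (fun a => (X.chargeP a, 1))

/-- `X.HomDeg s d`: the polynomial `s` is homogeneous of degree `d`. -/
def HomDeg (s : X.S) (d : Deg r) : Prop := MvPolynomial.IsWeightedHomogeneous X.weight s d

/-- The superpotential `W = ∑ p_a f_a(x)`. -/
def W : X.S :=
  ∑ a, MvPolynomial.X (Sum.inr a) * MvPolynomial.rename Sum.inl (X.f a)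

/-- `R`-degree `2` and toric degree `0`. -/
def degW (r : ℕ) : Deg r := (0, 1)

theorem W_homDeg : X.HomDeg X.W (degW r) := by
  unfold HomDeg W
  refine MvPolynomial.IsWeightedHomogeneous.sum _ _ _ fun a _ => ?_
  have h1 := MvPolynomial.isWeightedHomogeneous_X ℂ X.weight (Sum.inr a)
  have h2 : MvPolynomial.IsWeightedHomogeneous X.weight
      (MvPolynomial.rename Sum.inl (X.f a)) ((-X.chargeP a, 0) : Deg r) := by
    intro d hd
    obtain ⟨u, rfl, hu⟩ := MvPolynomial.coeff_rename_ne_zero _ _ _ hd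
    have := X.homogeneous a hu
    rw [← this]
    simp only [Finsupp.weight_apply]
    rw [Finsupp.sum_mapDomain_index (by simp) (by intros; rw [add_smul])]
    simp only [weight, Sum.elim_inl, Finsupp.sum]
    ext <;> simp [Prod.fst_sum, Prod.snd_sum]
  have h3 := h1.mul h2
  have e : X.weight (Sum.inr a) + ((-X.chargeP a, 0) : Deg r) = degW r := by
    simp [weight, degW]
  rwa [e] at h3

/-- The hypersurface ring `S' = S/(W)`. -/
abbrev S' : Type := X.S ⧸ Ideal.span {X.W}

/-- The graded pieces of `S`. -/
def pieceS (d : Deg r) : AddSubgroup X.S :=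
  (MvPolynomial.weightedHomogeneousSubmodule ℂ X.weight d).toAddSubgroup

/-- The graded pieces of `S'`: images of the graded pieces of `S`. -/
def pieceS' (d : Deg r) : AddSubgroup X.S' :=
  (X.pieceS d).map (Ideal.Quotient.mk (Ideal.span {X.W})).toAddMonoidHom

end SigmaModel

/-! ### Two helper facts on gradings -/

section Internal

variable {G : Type*} [DecidableEq G] {A B : Type*} [AddCommGroup A] [AddCommGroup B]

theorem isInternal_of_proj (p : G → AddSubgroup A) (π : G → A →+ A)
    (hmem : ∀ g a, π g a ∈ p g) (hfin : ∀ a, ∃ s : Finset G, a = ∑ g ∈ s, π g a)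
    (hself : ∀ g, ∀ a ∈ p g, π g a = a) (hne : ∀ g h, g ≠ h → ∀ a ∈ p g, π h a = 0) :
    DirectSum.IsInternal p := by
  have key : ∀ (x : DirectSum G fun g => p g) (h : G),
      π h (DirectSum.coeAddMonoidHom p x) = (x h : A) := by
    intro x h
    induction x using DirectSum.induction_on with
    | zero => simp
    | of g a =>
      rw [DirectSum.coeAddMonoidHom_of, DirectSum.coe_of_apply]
      split_ifs with e
      · subst e; exact hself _ _ a.2
      · simpa using hne g h e _ a.2
    | add x y hx hy => simp [hx, hy]
  refine ⟨fun x y hxy => ?_, fun a => ?_⟩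
  · ext h
    rw [← key x h, ← key y h, hxy]
  · obtain ⟨s, hs⟩ := hfin a
    refine ⟨∑ g ∈ s, DirectSum.of (fun g => p g) g ⟨π g a, hmem g a⟩, ?_⟩
    rw [map_sum]
    simp only [DirectSum.coeAddMonoidHom_of]
    exact hs.symm

theorem exists_proj_of_isInternal (p : G → AddSubgroup A) (h : DirectSum.IsInternal p) :
    ∃ π : G → A →+ A, (∀ g a, π g a ∈ p g) ∧ (∀ a, ∃ s : Finset G, ∀ t, s ⊆ t →
      a = ∑ g ∈ t, π g a) ∧ (∀ g, ∀ a ∈ p g, π g a = a) ∧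
      (∀ g h, g ≠ h → ∀ a ∈ p g, π h a = 0) := by
  classical
  let _ := h.chooseDecomposition
  refine ⟨fun g => (p g).subtype.comp
    ((DFinsupp.evalAddMonoidHom g).comp (DirectSum.decomposeAddEquiv p).toAddMonoidHom),
    fun g a => ?_, fun a => ?_, fun g a ha => ?_, fun g h hgh a ha => ?_⟩
  · simp
  · refine ⟨(DirectSum.decompose p a).support, fun t ht => ?_⟩
    conv_lhs => rw [← DirectSum.sum_support_decompose p a]
    refine Finset.sum_subset ht fun g _ hg => ?_
    simpa using hg
  · exact DirectSum.decompose_of_mem_same p ha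
  · exact DirectSum.decompose_of_mem_ne p ha hgh

/-- The quotient of a graded group by the range of a graded map is graded. -/
theorem isInternal_quotient (p : G → AddSubgroup A) (hp : DirectSum.IsInternal p)
    (K : AddSubgroup A) (q : G → AddSubgroup B) (hq : DirectSum.IsInternal q) (e : G ≃ G)
    (φ : B →+ A) (hφ : φ.range = K) (hdeg : ∀ g, ∀ b ∈ q g, φ b ∈ p (e g)) :
    DirectSum.IsInternal fun g => (p g).map (QuotientAddGroup.mk' K) := by
  obtain ⟨π, h1, h2, h3, h4⟩ := exists_proj_of_isInternal p hp
  obtain ⟨ρ, k1, k2, k3, k4⟩ := exists_proj_of_isInternal q hq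
  have comm : ∀ g b, π (e g) (φ b) = φ (ρ g b) := by
    intro g b
    obtain ⟨s, hs⟩ := k2 b
    have := hs (insert g s) (Finset.subset_insert _ _)
    conv_lhs => rw [this, map_sum, map_sum]
    rw [Finset.sum_eq_single g]
    · exact h3 _ _ (hdeg _ _ (k1 _ _))
    · intro h _ hh
      exact h4 _ _ (fun c => hh (e.injective c)) _ (hdeg _ _ (k1 _ _))
    · intro hg
      exact absurd (Finset.mem_insert_self _ _) hg
  have stab : ∀ g, K ≤ K.comap (π g) := by
    intro g a ha
    rw [← hφ] at ha
    obtain ⟨b, rfl⟩ := ha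
    rw [AddSubgroup.mem_comap, ← e.apply_symm_apply g, comm, ← hφ]
    exact ⟨_, rfl⟩
  refine isInternal_of_proj _ (fun g => QuotientAddGroup.map K K (π g) (stab g)) ?_ ?_ ?_ ?_
  · intro g a
    induction a using QuotientAddGroup.induction_on with
    | H a => exact ⟨π g a, h1 g a, rfl⟩
  · intro a
    induction a using QuotientAddGroup.induction_on with
    | H a =>
      obtain ⟨s, hs⟩ := h2 a
      refine ⟨s, ?_⟩
      simp only [QuotientAddGroup.map_mk]
      conv_lhs => rw [hs s subset_rfl]
      exact map_sum (QuotientAddGroup.mk' K) _ _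
  · rintro g _ ⟨a, ha, rfl⟩
    exact congrArg (QuotientAddGroup.mk' K) (h3 g a ha)
  · rintro g h hgh _ ⟨a, ha, rfl⟩
    refine (congrArg (QuotientAddGroup.mk' K) (h4 g h hgh a ha)).trans ?_
    simp

end Internal

namespace SigmaModel

variable {r n l : ℕ} (X : SigmaModel r n l)

theorem pieceS_isInternal : DirectSum.IsInternal X.pieceS := by
  classical
  refine isInternal_of_proj _
    (fun d => (MvPolynomial.weightedHomogeneousComponent X.weight d).toAddMonoidHom) ?_ ?_ ?_ ?_
  · intro g a
    exact MvPolynomial.weightedHomogeneousComponent_mem _ _ _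
  · intro a
    refine ⟨(MvPolynomial.weightedHomogeneousComponent_finsupp (w := X.weight) a).toFinset, ?_⟩
    conv_lhs => rw [← MvPolynomial.sum_weightedHomogeneousComponent X.weight a]
    rw [finsum_eq_sum _ (MvPolynomial.weightedHomogeneousComponent_finsupp (w := X.weight) a)]
    rfl
  · intro g a ha
    exact MvPolynomial.IsWeightedHomogeneous.weightedHomogeneousComponent_same ha
  · intro g h hgh a ha
    exact MvPolynomial.IsWeightedHomogeneous.weightedHomogeneousComponent_ne h ha hgh.symm

theorem pieceS'_isInternal : DirectSum.IsInternal X.pieceS' := by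
  refine isInternal_quotient X.pieceS X.pieceS_isInternal
    (Ideal.span {X.W} : Ideal X.S).toAddSubgroup X.pieceS X.pieceS_isInternal
    (Equiv.addRight (degW r)) (AddMonoidHom.mulRight X.W) ?_ ?_
  · ext s
    constructor
    · rintro ⟨t, rfl⟩
      exact Ideal.mem_span_singleton'.2 ⟨t, rfl⟩
    · intro hs
      exact Ideal.mem_span_singleton'.1 hs
  · intro g b hb
    exact MvPolynomial.IsWeightedHomogeneous.mul hb X.W_homDeg

theorem pieceS'_mul {d e : Deg r} {a b : X.S'} (ha : a ∈ X.pieceS' d) (hb : b ∈ X.pieceS' e) :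
    a * b ∈ X.pieceS' (d + e) := by
  obtain ⟨s, hs, rfl⟩ := ha
  obtain ⟨t, ht, rfl⟩ := hb
  exact ⟨s * t, MvPolynomial.IsWeightedHomogeneous.mul hs ht,
    map_mul (Ideal.Quotient.mk (Ideal.span {X.W})) s t⟩

/-! ### Finitely generated graded `S'`-modules -/

/-- A finitely generated graded `S'`-module. -/
structure GrMod where
  /-- the underlying module -/
  carrier : Type
  [addCommGroup : AddCommGroup carrier]
  [module : Module X.S' carrier]
  [finite : Module.Finite X.S' carrier]
  /-- the graded pieces -/
  piece : Deg r → AddSubgroup carrier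
  isInternal : DirectSum.IsInternal piece
  smul_mem : ∀ {d e : Deg r} {s : X.S'} {m : carrier},
    s ∈ X.pieceS' d → m ∈ piece e → s • m ∈ piece (d + e)

attribute [instance] GrMod.addCommGroup GrMod.module GrMod.finite

variable {X}

/-- The degree-preserving `S'`-linear maps. -/
def GrMod.homs (M N : X.GrMod) : AddSubgroup (M.carrier →ₗ[X.S'] N.carrier) where
  carrier := {φ | ∀ d, ∀ m ∈ M.piece d, φ m ∈ N.piece d}
  zero_mem' := fun _ _ _ => zero_mem _
  add_mem' := fun ha hb d m hm => add_mem (ha d m hm) (hb d m hm)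
  neg_mem' := fun ha d m hm => neg_mem (ha d m hm)

instance : Category X.GrMod where
  Hom M N := M.homs N
  id M := ⟨LinearMap.id, fun _ _ hm => hm⟩
  comp φ ψ := ⟨ψ.1 ∘ₗ φ.1, fun d m hm => ψ.2 d _ (φ.2 d m hm)⟩

instance (M N : X.GrMod) : AddCommGroup (M ⟶ N) := inferInstanceAs (AddCommGroup (M.homs N))

theorem GrMod.hom_ext {M N : X.GrMod} {φ ψ : M ⟶ N} (h : φ.1 = ψ.1) : φ = ψ := Subtype.ext h

instance : Preadditive X.GrMod where
  add_comp M N P φ φ' ψ := GrMod.hom_ext (LinearMap.comp_add φ.1 φ'.1 ψ.1)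
  comp_add M N P φ ψ ψ' := GrMod.hom_ext (LinearMap.add_comp φ.1 ψ'.1 ψ.1)

variable (X) in
/-- Forgetting the grading. -/
def forgetGrading : X.GrMod ⥤ ModuleCat.{0} X.S' where
  obj M := ModuleCat.of X.S' M.carrier
  map φ := ModuleCat.ofHom φ.1

instance : (forgetGrading X).Additive where
  map_add {_ _ φ ψ} := ModuleCat.hom_ext (rfl : (φ + ψ).1 = φ.1 + ψ.1)

/-- Direct sum of two graded modules. -/
def GrMod.prod (M N : X.GrMod) : X.GrMod where
  carrier := M.carrier × N.carrier
  piece d := (M.piece d).prod (N.piece d)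
  isInternal := by
    obtain ⟨π, h1, h2, h3, h4⟩ := exists_proj_of_isInternal _ M.isInternal
    obtain ⟨ρ, k1, k2, k3, k4⟩ := exists_proj_of_isInternal _ N.isInternal
    refine isInternal_of_proj _ (fun d => (π d).prodMap (ρ d)) ?_ ?_ ?_ ?_
    · exact fun g a => ⟨h1 g a.1, k1 g a.2⟩
    · intro a
      obtain ⟨s, hs⟩ := h2 a.1
      obtain ⟨t, ht⟩ := k2 a.2
      refine ⟨s ∪ t, Prod.ext ?_ ?_⟩
      · rw [Prod.fst_sum]
        exact hs _ Finset.subset_union_left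
      · rw [Prod.snd_sum]
        exact ht _ Finset.subset_union_right
    · exact fun g a ha => Prod.ext (h3 g _ ha.1) (k3 g _ ha.2)
    · exact fun g h hgh a ha => Prod.ext (h4 g h hgh _ ha.1) (k4 g h hgh _ ha.2)
  smul_mem hs hm := ⟨M.smul_mem hs hm.1, N.smul_mem hs hm.2⟩

instance : Limits.HasBinaryBiproducts X.GrMod where
  has_binary_biproduct M N := ⟨⟨⟨
    { pt := M.prod N
      fst := ⟨LinearMap.fst _ _ _, fun _ _ hm => hm.1⟩
      snd := ⟨LinearMap.snd _ _ _, fun _ _ hm => hm.2⟩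
      inl := ⟨LinearMap.inl _ _ _, fun _ _ hm => ⟨hm, zero_mem _⟩⟩
      inr := ⟨LinearMap.inr _ _ _, fun _ _ hm => ⟨zero_mem _, hm⟩⟩
      inl_fst := rfl
      inl_snd := GrMod.hom_ext (LinearMap.snd_comp_inl X.S' M.carrier N.carrier)
      inr_fst := GrMod.hom_ext (LinearMap.fst_comp_inr X.S' M.carrier N.carrier)
      inr_snd := rfl },
    Limits.isBinaryBilimitOfTotal _ (GrMod.hom_ext (LinearMap.ext
      fun m : M.carrier × N.carrier => Prod.ext (add_zero m.1) (zero_add m.2)))⟩⟩⟩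

/-- The cokernel of a map of graded modules. -/
def GrMod.coker {M N : X.GrMod} (φ : M ⟶ N) : X.GrMod where
  carrier := N.carrier ⧸ LinearMap.range φ.1
  piece d := (N.piece d).map (LinearMap.range φ.1).mkQ.toAddMonoidHom
  isInternal := by
    refine isInternal_quotient N.piece N.isInternal (LinearMap.range φ.1).toAddSubgroup
      M.piece M.isInternal (Equiv.refl _) φ.1.toAddMonoidHom ?_ φ.2
    ext m
    exact Iff.rfl
  smul_mem := by
    rintro d e s _ hs ⟨m, hm, rfl⟩
    exact ⟨s • m, N.smul_mem hs hm, rfl⟩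

end SigmaModel

/-! ### Graded free modules of finite rank -/

/-- The degrees of a graded free module of finite rank: `⊕_i S(v_i){2 m_i}` with
`deg i = (v_i, m_i)`. The `i`-th basis vector has degree `-deg i`. -/
structure FreeData (r : ℕ) where
  /-- the index set of the basis -/
  ι : Type
  [fintype : Fintype ι]
  [decEq : DecidableEq ι]
  /-- the shifts -/
  deg : ι → Deg r

attribute [instance] FreeData.fintype FreeData.decEq

namespace FreeData

variable {r : ℕ}

/-- The shift of the grading by `e`. -/
@[reducible]
def shift (P : FreeData r) (e : Deg r) : FreeData r where
  ι := P.ι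
  deg i := P.deg i + e

/-- Direct sum. -/
@[reducible]
def sum (P Q : FreeData r) : FreeData r where
  ι := P.ι ⊕ Q.ι
  deg := Sum.elim P.deg Q.deg

end FreeData

namespace SigmaModel

variable {r n l : ℕ} {X : SigmaModel r n l}

variable (X) in
/-- The graded free `S'`-module `⊕_i S'(v_i){2 m_i}`; its piece of degree `d` consists of the
vectors whose `i`-th entry lies in the piece of degree `d + (v_i, m_i)` of `S'`. -/
def freeMod (P : FreeData r) : X.GrMod where
  carrier := P.ι → X.S'
  piece d := AddSubgroup.pi Set.univ fun i => X.pieceS' (d + P.deg i)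
  isInternal := by
    obtain ⟨π, h1, h2, h3, h4⟩ := exists_proj_of_isInternal _ X.pieceS'_isInternal
    refine isInternal_of_proj _ (fun d => AddMonoidHom.mk'
      (fun v i => π (d + P.deg i) (v i)) (fun v w => funext fun i => map_add _ _ _)) ?_ ?_ ?_ ?_
    · exact fun g a i _ => h1 _ _
    · intro a
      choose s hs using fun i => h2 (a i)
      refine ⟨Finset.univ.biUnion fun i => (s i).map (Equiv.subRight (P.deg i)).toEmbedding, ?_⟩
      funext i
      rw [Finset.sum_apply]
      refine (hs i ((Finset.univ.biUnion fun i =>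
        (s i).map (Equiv.subRight (P.deg i)).toEmbedding).map
          (Equiv.addRight (P.deg i)).toEmbedding) ?_).trans ?_
      · intro d hd
        rw [Finset.mem_map]
        refine ⟨d - P.deg i, ?_, by simp⟩
        exact Finset.mem_biUnion.2 ⟨i, Finset.mem_univ _, Finset.mem_map.2 ⟨d, hd, rfl⟩⟩
      · rw [Finset.sum_map]
        rfl
    · exact fun g a ha => funext fun i => h3 _ _ (ha i trivial)
    · exact fun g h hgh a ha => funext fun i =>
        h4 _ _ (fun c => hgh (add_right_cancel c)) _ (ha i trivial)
  smul_mem := by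
    intro d e s m hs hm i _
    have := X.pieceS'_mul hs (hm i trivial)
    rwa [← add_assoc] at this

/-- The zero module is a zero object. -/
instance : Limits.HasZeroObject X.GrMod where
  zero := ⟨X.freeMod { ι := Empty, deg := Empty.elim },
    { unique_to := fun N => ⟨⟨⟨0⟩, fun φ => GrMod.hom_ext (LinearMap.ext fun v => by
        have : v = 0 := funext fun i => i.elim
        rw [this, map_zero, map_zero])⟩⟩
      unique_from := fun N => ⟨⟨⟨0⟩, fun φ => GrMod.hom_ext (LinearMap.ext fun v =>
        funext fun i => i.elim)⟩⟩ }⟩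

/-! ### Complexes of graded modules, `D(gr-S')` and `D(gr-S')/Perf(S')` -/

/-- Bounded complexes; the bounded complexes of finitely generated graded `S'`-modules are the
objects of `D(gr-S')`. -/
def Bounded (K : CochainComplex X.GrMod ℤ) : Prop :=
  ∃ a b : ℤ, K.IsStrictlyGE a ∧ K.IsStrictlyLE b

/-- Quasi-isomorphisms of complexes of graded modules. -/
def IsQis {K L : CochainComplex X.GrMod ℤ} (φ : K ⟶ L) : Prop :=
  QuasiIso (((forgetGrading X).mapHomologicalComplex (ComplexShape.up ℤ)).map φ)

/-- Perfect complexes: those quasi-isomorphic to a finite length complex of finitely generated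
graded free modules. -/
def Perfect (K : CochainComplex X.GrMod ℤ) : Prop :=
  ∃ (L : CochainComplex X.GrMod ℤ) (φ : L ⟶ K), Bounded L ∧
    (∀ i, ∃ P : FreeData r, Nonempty (L.X i ≅ X.freeMod P)) ∧ IsQis φ

/-- Isomorphism in the Verdier quotient `D(gr-S')/Perf(S')`: a roof `K ← Z → L` of bounded
complexes such that the cones of both maps are perfect. -/
def IsoModPerf (K L : CochainComplex X.GrMod ℤ) : Prop :=
  ∃ (Z : CochainComplex X.GrMod ℤ) (φ : Z ⟶ K) (ψ : Z ⟶ L), Bounded Z ∧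
    Perfect (CochainComplex.mappingCone φ) ∧ Perfect (CochainComplex.mappingCone ψ)

/-- A resolution `F → M` of a complex `M` by graded free `S'`-modules of finite rank. -/
structure FreeResolution (M : CochainComplex X.GrMod ℤ) where
  /-- the complex of free modules -/
  F : CochainComplex X.GrMod ℤ
  /-- the degrees of the generators of `F^i` -/
  gens : ℤ → FreeData r
  /-- a homogeneous basis of `F^i` -/
  basis : ∀ i, F.X i ≅ X.freeMod (gens i)
  /-- the complex `F` is bounded above (in homological notation: bounded below) -/
  bounded : ∃ b : ℤ, F.IsStrictlyLE b
  /-- the augmentation -/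
  aug : F ⟶ M
  isQis : IsQis aug

end SigmaModel

/-! ### Formal power series in `s_i^{±1}, σ^{±1}` and the class `k` -/

/-- The group `ℤ[[s_1^{±1}, …, s_r^{±1}, σ^{±1}]]` of two-sided formal series: `K v n` is the
coefficient of `s^v σ^n`. -/
abbrev FormalSeries (r : ℕ) : Type := (Fin r → ℤ) → ℤ → ℤ

/-- The Laurent polynomials `ℤ[s_1^{±1}, …, s_r^{±1}]`. -/
abbrev LaurentS (r : ℕ) : Type := AddMonoidAlgebra ℤ (Fin r → ℤ)

/-- The Laurent polynomials `ℤ[s_1^{±1}, …, s_r^{±1}, σ^{±1}]`. -/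
abbrev LaurentSσ (r : ℕ) : Type := AddMonoidAlgebra ℤ ((Fin r → ℤ) × ℤ)

namespace SigmaModel.FreeResolution

variable {r n l : ℕ} {X : SigmaModel r n l} {M : CochainComplex X.GrMod ℤ}

/-- The number of summands `S'(v){2m}` in `F^i`. -/
def mult (R : FreeResolution M) (i : ℤ) (v : Fin r → ℤ) (m : ℤ) : ℕ :=
  Fintype.card {j : (R.gens i).ι // (R.gens i).deg j = (v, m)}

/-- For all `v, m` only finitely many `F^i` have a summand `S'(v){2m}`, so that the sum
`∑_i (-1)^i k(F^i)` makes sense as a formal series. -/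
def Summable (R : FreeResolution M) : Prop :=
  ∀ v m, {i : ℤ | R.mult i v m ≠ 0}.Finite

/-- The series `∑_i (-1)^i k(F^i)`, where `k(S'(v){2m}) = s^v σ^{-2m}`. -/
def series (R : FreeResolution M) : FormalSeries r := fun v k =>
  ∑ᶠ (m : ℤ) (_ : k = -(2 * m)), ∑ᶠ i : ℤ, (i.negOnePow : ℤ) * (R.mult i v m : ℤ)

end SigmaModel.FreeResolution

/-- The formal series `K` equals
`f (1 + σ^2 + σ^4 + ⋯) + g = f / (1 - σ^2) + g`. -/
def HasPeriodicForm {r : ℕ} (K : FormalSeries r) (f g : LaurentSσ r) : Prop :=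
  ∀ v k, K v k = (∑ᶠ i : ℕ, f.coeff (v, k - 2 * (i : ℤ))) + g.coeff (v, k)

/-- The coefficient of `s^v` in `f`, evaluated at the complex number `σ = z`. -/
def evalσ {r : ℕ} (f : LaurentSσ r) (v : Fin r → ℤ) (z : ℂ) : ℂ :=
  ∑ᶠ k : ℤ, (f.coeff (v, k) : ℂ) * z ^ k

/-- The coefficient of `s^v` in `(1/πi) ∮_γ (f / (1 - σ^2) + g) dσ`, where `γ` is the circle of
radius `ε` around `σ = 1`, run through clockwise. (Mathlib's `∮` runs counterclockwise, whence
the minus sign.) -/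
def contourIntegral {r : ℕ} (f g : LaurentSσ r) (v : Fin r → ℤ) (ε : ℝ) : ℂ :=
  (1 / (Real.pi * Complex.I)) *
    -(∮ z in C(1, ε), (evalσ f v z / (1 - z ^ 2) + evalσ g v z))

/-! ### The category `DGr S(W)` of graded matrix factorizations -/

namespace SigmaModel

variable {r n l : ℕ} (X : SigmaModel r n l)

/-- A matrix with entries in `S` defines a map `⊕ S(v_j){2 m_j} → ⊕ S(w_i){2 k_i}` which is
homogeneous of degree `e`. -/
def IsHomMat (P Q : FreeData r) (e : Deg r) (A : Matrix Q.ι P.ι X.S) : Prop :=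
  ∀ i j, X.HomDeg (A i j) (Q.deg i - P.deg j + e)

/-- A graded matrix factorization of `W`: graded free `S`-modules of finite rank with maps
`u₁ : P₁ → P₀` of degree `0` and `u₀ : P₀ → P₁` of toric degree `0` and `R`-degree `2`. -/
structure MF where
  P₁ : FreeData r
  P₀ : FreeData r
  u₁ : Matrix P₀.ι P₁.ι X.S
  u₀ : Matrix P₁.ι P₀.ι X.S
  deg_u₁ : X.IsHomMat P₁ P₀ 0 u₁
  deg_u₀ : X.IsHomMat P₀ P₁ (degW r) u₀
  u₀_u₁ : u₀ * u₁ = X.W • (1 : Matrix P₁.ι P₁.ι X.S)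
  u₁_u₀ : u₁ * u₀ = X.W • (1 : Matrix P₀.ι P₀.ι X.S)

variable {X}

theorem HomDeg.of_eq {s : X.S} {d e : Deg r} (h : X.HomDeg s d) (he : d = e) : X.HomDeg s e :=
  he ▸ h

theorem IsHomMat.mul {P Q T : FreeData r} {d e : Deg r} {A : Matrix Q.ι P.ι X.S}
    {B : Matrix T.ι Q.ι X.S} (hB : X.IsHomMat Q T e B) (hA : X.IsHomMat P Q d A) :
    X.IsHomMat P T (e + d) (B * A) := by
  intro i j
  refine MvPolynomial.IsWeightedHomogeneous.sum _ _ _ fun k _ => ?_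
  have := MvPolynomial.IsWeightedHomogeneous.mul (hB i k) (hA k j)
  have e : T.deg i - Q.deg k + e + (Q.deg k - P.deg j + d) = T.deg i - P.deg j + (e + d) := by
    abel
  rwa [e] at this

theorem IsHomMat.one (P : FreeData r) : X.IsHomMat P P 0 1 := by
  intro i j
  by_cases h : i = j
  · subst h
    simpa [HomDeg] using MvPolynomial.isWeightedHomogeneous_one ℂ X.weight
  · rw [Matrix.one_apply_ne h]
    exact MvPolynomial.isWeightedHomogeneous_zero _ _ _

theorem IsHomMat.neg {P Q : FreeData r} {d : Deg r} {A : Matrix Q.ι P.ι X.S}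
    (hA : X.IsHomMat P Q d A) : X.IsHomMat P Q d (-A) :=
  fun i j => MvPolynomial.IsWeightedHomogeneous.neg (hA i j)

/-- A (strict) morphism of matrix factorizations. -/
@[ext]
structure MF.Hom (a b : X.MF) where
  f₁ : Matrix b.P₁.ι a.P₁.ι X.S
  f₀ : Matrix b.P₀.ι a.P₀.ι X.S
  deg_f₁ : X.IsHomMat a.P₁ b.P₁ 0 f₁
  deg_f₀ : X.IsHomMat a.P₀ b.P₀ 0 f₀
  comm₁ : f₀ * a.u₁ = b.u₁ * f₁
  comm₀ : f₁ * a.u₀ = b.u₀ * f₀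

instance : Category X.MF where
  Hom a b := MF.Hom a b
  id a :=
    { f₁ := 1
      f₀ := 1
      deg_f₁ := IsHomMat.one _
      deg_f₀ := IsHomMat.one _
      comm₁ := by simp
      comm₀ := by simp }
  comp {a b c} φ ψ :=
    { f₁ := ψ.f₁ * φ.f₁
      f₀ := ψ.f₀ * φ.f₀
      deg_f₁ := by simpa using ψ.deg_f₁.mul φ.deg_f₁
      deg_f₀ := by simpa using ψ.deg_f₀.mul φ.deg_f₀
      comm₁ := by rw [Matrix.mul_assoc, φ.comm₁, ← Matrix.mul_assoc, ψ.comm₁, Matrix.mul_assoc]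
      comm₀ := by rw [Matrix.mul_assoc, φ.comm₀, ← Matrix.mul_assoc, ψ.comm₀, Matrix.mul_assoc] }
  id_comp φ := MF.Hom.ext (Matrix.mul_one _) (Matrix.mul_one _)
  comp_id φ := MF.Hom.ext (Matrix.one_mul _) (Matrix.one_mul _)
  assoc φ ψ χ := MF.Hom.ext (Matrix.mul_assoc _ _ _).symm (Matrix.mul_assoc _ _ _).symm

variable (X) in
/-- Homotopy of morphisms: `φ - ψ = v h + h u` for homogeneous maps `h₀ : P₀ → Q₁` of degree `0`
and `h₁ : P₁ → Q₀` of `R`-degree `-2`. -/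
def homotopic : HomRel X.MF := fun a b φ ψ =>
  ∃ (h₀ : Matrix b.P₁.ι a.P₀.ι X.S) (h₁ : Matrix b.P₀.ι a.P₁.ι X.S),
    X.IsHomMat a.P₀ b.P₁ 0 h₀ ∧ X.IsHomMat a.P₁ b.P₀ (-degW r) h₁ ∧
    MF.Hom.f₁ φ = MF.Hom.f₁ ψ + (b.u₀ * h₁ + h₀ * a.u₁) ∧
    MF.Hom.f₀ φ = MF.Hom.f₀ ψ + (b.u₁ * h₀ + h₁ * a.u₀)

variable (X) in
/-- The category `DGr S(W)`: matrix factorizations and homotopy classes of morphisms. -/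
abbrev DGr : Type 1 := CategoryTheory.Quotient X.homotopic

/-- The shift `P[1] = (P₀ ⇄ P₁{2})`. -/
@[reducible]
def MF.shift (a : X.MF) : X.MF where
  P₁ := a.P₀
  P₀ := a.P₁.shift (degW r)
  u₁ := a.u₀
  u₀ := a.u₁
  deg_u₁ := fun i j => (a.deg_u₀ i j).of_eq (by
    change a.P₁.deg i - a.P₀.deg j + degW r = a.P₁.deg i + degW r - a.P₀.deg j + 0
    abel)
  deg_u₀ := fun i j => (a.deg_u₁ i j).of_eq (by
    change a.P₀.deg i - a.P₁.deg j + 0 = a.P₀.deg i - (a.P₁.deg j + degW r) + degW r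
    abel)
  u₀_u₁ := a.u₁_u₀
  u₁_u₀ := a.u₀_u₁

variable (X) in
/-- The shift functor on strict morphisms. -/
def shiftMF : X.MF ⥤ X.MF where
  obj a := a.shift
  map {a b} φ :=
    { f₁ := MF.Hom.f₀ φ
      f₀ := MF.Hom.f₁ φ
      deg_f₁ := MF.Hom.deg_f₀ φ
      deg_f₀ := fun i j => (MF.Hom.deg_f₁ φ i j).of_eq (by
        change b.P₁.deg i - a.P₁.deg j + 0
          = b.P₁.deg i + degW r - (a.P₁.deg j + degW r) + 0
        abel)
      comm₁ := MF.Hom.comm₀ φ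
      comm₀ := MF.Hom.comm₁ φ }

variable (X) in
/-- The shift functor `[1]` on `DGr S(W)`. -/
def shiftDGr : X.DGr ⥤ X.DGr :=
  CategoryTheory.Quotient.lift _ (X.shiftMF ⋙ CategoryTheory.Quotient.functor _) (by
    rintro a b φ ψ ⟨h₀, h₁, d₀, d₁, e₁, e₀⟩
    refine CategoryTheory.Quotient.sound _ ⟨h₁, h₀, fun i j => (d₁ i j).of_eq ?_,
      fun i j => (d₀ i j).of_eq ?_, ?_, ?_⟩
    · change b.P₀.deg i - a.P₁.deg j + -degW r = b.P₀.deg i - (a.P₁.deg j + degW r) + 0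
      abel
    · change b.P₁.deg i - a.P₀.deg j + 0 = b.P₁.deg i + degW r - a.P₀.deg j + -degW r
      abel
    · exact e₀
    · exact e₁)

/-- The mapping cone of a morphism `φ : a → b`, with `C₁ = b₁ ⊕ a₀` and `C₀ = b₀ ⊕ a₁{2}`. -/
@[reducible]
def MF.cone {a b : X.MF} (φ : a ⟶ b) : X.MF where
  P₁ := b.P₁.sum a.P₀
  P₀ := b.P₀.sum (a.P₁.shift (degW r))
  u₁ := Matrix.fromBlocks b.u₁ (MF.Hom.f₀ φ) 0 a.u₀
  u₀ := Matrix.fromBlocks b.u₀ (-MF.Hom.f₁ φ) 0 a.u₁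
  deg_u₁ := by
    rintro (i | i) (j | j)
    · exact b.deg_u₁ i j
    · exact MF.Hom.deg_f₀ φ i j
    · exact MvPolynomial.isWeightedHomogeneous_zero _ _ _
    · exact a.shift.deg_u₁ i j
  deg_u₀ := by
    rintro (i | i) (j | j)
    · exact b.deg_u₀ i j
    · refine ((MF.Hom.deg_f₁ φ).neg i j).of_eq ?_
      change b.P₁.deg i - a.P₁.deg j + 0 = b.P₁.deg i - (a.P₁.deg j + degW r) + degW r
      abel
    · exact MvPolynomial.isWeightedHomogeneous_zero _ _ _
    · exact a.shift.deg_u₀ i j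
  u₀_u₁ := by
    refine (Matrix.fromBlocks_multiply _ _ _ _ _ _ _ _).trans ?_
    have h := MF.Hom.comm₀ φ
    have e : b.u₀ * MF.Hom.f₀ φ + -MF.Hom.f₁ φ * a.u₀ = 0 := by
      rw [Matrix.neg_mul, ← h, add_neg_cancel]
    rw [e, b.u₀_u₁, a.u₁_u₀]
    simp only [Matrix.zero_mul, Matrix.mul_zero, add_zero, zero_add]
    refine Eq.trans ?_ (congrArg (X.W • ·) Matrix.fromBlocks_one)
    rw [Matrix.fromBlocks_smul, smul_zero, smul_zero]
  u₁_u₀ := by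
    refine (Matrix.fromBlocks_multiply _ _ _ _ _ _ _ _).trans ?_
    have h := MF.Hom.comm₁ φ
    have e : b.u₁ * -MF.Hom.f₁ φ + MF.Hom.f₀ φ * a.u₁ = 0 := by
      rw [Matrix.mul_neg, h, neg_add_cancel]
    rw [e, b.u₁_u₀, a.u₀_u₁]
    simp only [Matrix.zero_mul, Matrix.mul_zero, add_zero, zero_add]
    refine Eq.trans ?_ (congrArg (X.W • ·) Matrix.fromBlocks_one)
    rw [Matrix.fromBlocks_smul, smul_zero, smul_zero]

/-- The inclusion `b → cone φ`. -/
def MF.coneInl {a b : X.MF} (φ : a ⟶ b) : b ⟶ MF.cone φ :=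
  MF.Hom.mk (a := b) (b := MF.cone φ)
    (Matrix.fromRows (1 : Matrix b.P₁.ι b.P₁.ι X.S) (0 : Matrix a.P₀.ι b.P₁.ι X.S))
    (Matrix.fromRows (1 : Matrix b.P₀.ι b.P₀.ι X.S) (0 : Matrix a.P₁.ι b.P₀.ι X.S))
    (by
      rintro (i | i) j
      · exact IsHomMat.one _ i j
      · exact MvPolynomial.isWeightedHomogeneous_zero _ _ _)
    (by
      rintro (i | i) j
      · exact IsHomMat.one _ i j
      · exact MvPolynomial.isWeightedHomogeneous_zero _ _ _)
    (by
      refine (Matrix.fromRows_mul _ _ _).trans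
        (Eq.trans ?_ (Matrix.fromBlocks_mul_fromRows _ _ _ _ _ _).symm)
      simp)
    (by
      refine (Matrix.fromRows_mul _ _ _).trans
        (Eq.trans ?_ (Matrix.fromBlocks_mul_fromRows _ _ _ _ _ _).symm)
      simp)

/-- The projection `cone φ → a[1]`. -/
def MF.coneProj {a b : X.MF} (φ : a ⟶ b) : MF.cone φ ⟶ a.shift :=
  MF.Hom.mk (a := MF.cone φ) (b := a.shift)
    (Matrix.fromCols (0 : Matrix a.P₀.ι b.P₁.ι X.S) (1 : Matrix a.P₀.ι a.P₀.ι X.S))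
    (Matrix.fromCols (0 : Matrix a.P₁.ι b.P₀.ι X.S) (1 : Matrix a.P₁.ι a.P₁.ι X.S))
    (by
      rintro i (j | j)
      · exact MvPolynomial.isWeightedHomogeneous_zero _ _ _
      · exact IsHomMat.one _ i j)
    (by
      rintro i (j | j)
      · exact MvPolynomial.isWeightedHomogeneous_zero _ _ _
      · exact IsHomMat.one (a.P₁.shift (degW r)) i j)
    (by
      refine (Matrix.fromCols_mul_fromBlocks _ _ _ _ _ _).trans
        (Eq.trans (congrArg₂ Matrix.fromCols ?_ ?_) (Matrix.mul_fromCols _ _ _).symm)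
      · rw [Matrix.zero_mul, Matrix.mul_zero, Matrix.mul_zero, add_zero]
      · rw [Matrix.zero_mul, Matrix.one_mul, zero_add]
        exact (Matrix.mul_one _).symm)
    (by
      refine (Matrix.fromCols_mul_fromBlocks _ _ _ _ _ _).trans
        (Eq.trans (congrArg₂ Matrix.fromCols ?_ ?_) (Matrix.mul_fromCols _ _ _).symm)
      · rw [Matrix.zero_mul, Matrix.mul_zero, Matrix.mul_zero, add_zero]
      · rw [Matrix.zero_mul, Matrix.one_mul, zero_add]
        exact (Matrix.mul_one _).symm)

variable (X) in
/-- The object of `DGr S(W)` given by a matrix factorization, and the class of a morphism. -/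
abbrev toDGr : X.MF ⥤ X.DGr := CategoryTheory.Quotient.functor X.homotopic

/-- The distinguished triangles `A → B → C → A[1]` of `DGr S(W)`: those isomorphic to
`a → b → cone φ → a[1]` for some morphism `φ : a → b` of matrix factorizations. -/
def Distinguished {A B C : X.DGr} (f : A ⟶ B) (g : B ⟶ C) (h : C ⟶ X.shiftDGr.obj A) : Prop :=
  ∃ (a b : X.MF) (φ : a ⟶ b) (α : A ≅ X.toDGr.obj a) (β : B ≅ X.toDGr.obj b)
    (γ : C ≅ X.toDGr.obj (MF.cone φ)),
    f ≫ β.hom = α.hom ≫ X.toDGr.map φ ∧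
    g ≫ γ.hom = β.hom ≫ X.toDGr.map (MF.coneInl φ) ∧
    h ≫ X.shiftDGr.map α.hom = γ.hom ≫ X.toDGr.map (MF.coneProj φ)

variable (X) in
/-- The relations `[A] - [B] + [C]` for distinguished triangles `A → B → C → A[1]`. -/
def K₀Relations : Set (FreeAbelianGroup X.DGr) :=
  {x | ∃ (A B C : X.DGr) (f : A ⟶ B) (g : B ⟶ C) (h : C ⟶ X.shiftDGr.obj A),
    Distinguished f g h ∧
    x = FreeAbelianGroup.of A - FreeAbelianGroup.of B + FreeAbelianGroup.of C}

variable (X) in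
/-- The `K`-group of the triangulated category `DGr S(W)`. -/
abbrev K₀ : Type 1 := FreeAbelianGroup X.DGr ⧸ AddSubgroup.closure X.K₀Relations

/-- The class of an object in the `K`-group. -/
def K₀.cls (A : X.DGr) : X.K₀ := QuotientAddGroup.mk (FreeAbelianGroup.of A)

/-! ### The correspondence between matrix factorizations and graded `S'`-modules -/

/-- The map `u₁ ⊗ S' : P₁ ⊗ S' → P₀ ⊗ S'` of graded free `S'`-modules. -/
def MF.u₁' (a : X.MF) : X.freeMod a.P₁ ⟶ X.freeMod a.P₀ :=
  ⟨Matrix.mulVecLin (a.u₁.map (Ideal.Quotient.mk (Ideal.span {X.W}))), fun d v hv i _ => by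
    refine AddSubgroup.sum_mem (X.pieceS' (d + a.P₀.deg i)) fun j _ => ?_
    have h1 : Ideal.Quotient.mk (Ideal.span {X.W}) (a.u₁ i j)
        ∈ X.pieceS' (a.P₀.deg i - a.P₁.deg j + 0) := ⟨_, a.deg_u₁ i j, rfl⟩
    have h2 := X.pieceS'_mul h1 (hv j trivial)
    rwa [show a.P₀.deg i - a.P₁.deg j + 0 + (d + a.P₁.deg j) = d + a.P₀.deg i from by abel]
      at h2⟩

/-- The graded `S'`-module `coker(u₁ : P₁ → P₀)`. (It is annihilated by `W`, so it is
`coker(u₁ ⊗ S')`.) -/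
def MF.cokerMod (a : X.MF) : X.GrMod := GrMod.coker a.u₁'

/-- `M` in `D(gr-S')` represents the matrix factorization `a` under the equivalence
`DGr S(W) ≅ D(gr-S')/Perf(S')` induced by `a ↦ coker(u₁ : P₁ → P₀)`: the complex `M` and the
module `coker(u₁)`, placed in degree `0`, are isomorphic in `D(gr-S')/Perf(S')`. -/
def Represents (M : CochainComplex X.GrMod ℤ) (a : X.MF) : Prop :=
  Bounded M ∧ IsoModPerf M ((HomologicalComplex.single X.GrMod (ComplexShape.up ℤ) 0).obj a.cokerMod)

end SigmaModel

end

noncomputable section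

namespace SigmaModel

variable {r n l : ℕ} {X : SigmaModel r n l}

/-! ### Morphisms of graded modules -/

/-! Since `S` is a domain and `W ≠ 0`, reducing a matrix factorization modulo `W` and unrolling it
gives a resolution `⋯ → P₁{-2} → P₀{-2} → P₁ → P₀` of `coker u₁` by free `S'`-modules
(`MF.exact_u₁'`, `MF.isQis_periodicAug`). Going two steps to the left multiplies the class by `σ²`,
so its class is `(k(P₀) - k(P₁)) / (1 - σ²)` (`MF.euler_periodicCx`).

The class does not depend on the resolution. Two resolutions of the same complex are linked by a
comparison map whose cone is acyclic, bounded above and free, hence contractible. A contractible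
complex has Euler characteristic zero in every degree (`FreeCx.euler_eq_zero`): evaluated at the
origin, a homogeneous matrix keeps only its entries of degree `0`, and the trace of the identity `dh
+ hd` telescopes. Perfect complexes have finite free resolutions, so an isomorphism modulo `Perf`
changes `k` by a Laurent polynomial only (`HasRes.of_isoModPerf`). Hence `k(M) = f/(1 - σ²) + g`
with `f = k(P₀) - k(P₁)`. For any such presentation `f|_{σ=1}` can be read off the series, because
it is the sum of two consecutive coefficients far out (`HasPeriodicForm.exists_sum_eq`); the contour
integral is a residue computation (`contourIntegral_eq`).

It remains to see that `κ(P) = (k(P₀) - k(P₁))|_{σ=1}` is defined on the `K`-group. It is the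
supertrace of the identity at the origin, in each toric degree, and supertraces are cyclic and
homotopy invariant, so isomorphic objects of `DGr S(W)` have the same value
(`MF.toricLaurent_eq_of_iso`). At `σ = 1` the shift `{2}` is invisible, which makes the value
additive on cones. Uniqueness holds because every factorization is represented by its own cokernel
and these classes generate the `K`-group. -/

theorem GrMod.comp_apply {M N P : X.GrMod} (φ : M ⟶ N) (ψ : N ⟶ P) (m : M.carrier) :
    (φ ≫ ψ).1 m = ψ.1 (φ.1 m) := rfl

theorem GrMod.id_apply {M : X.GrMod} (m : M.carrier) : (𝟙 M : M ⟶ M).1 m = m := rfl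

theorem GrMod.zero_apply {M N : X.GrMod} (m : M.carrier) : (0 : M ⟶ N).1 m = 0 := rfl

theorem one_mem_pieceS' : (1 : X.S') ∈ X.pieceS' 0 :=
  ⟨1, MvPolynomial.isWeightedHomogeneous_one ℂ X.weight,
    map_one (Ideal.Quotient.mk (Ideal.span {X.W}))⟩

/-- The standard basis of a graded free module. -/
def basisVec (P : FreeData r) (j : P.ι) : (X.freeMod P).carrier :=
  (Pi.single j 1 : P.ι → X.S')

theorem basisVec_mem_piece (P : FreeData r) (j : P.ι) :
    basisVec P j ∈ (X.freeMod P).piece (-P.deg j) := by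
  intro i _
  change (Pi.single j 1 : P.ι → X.S') i ∈ X.pieceS' (-P.deg j + P.deg i)
  by_cases h : i = j
  · subst h
    rw [Pi.single_eq_same, neg_add_cancel]
    exact one_mem_pieceS'
  · rw [Pi.single_eq_of_ne h]
    exact zero_mem _

theorem freeMod_hom_ext {P : FreeData r} {N : X.GrMod} {φ ψ : X.freeMod P ⟶ N}
    (h : ∀ j, φ.1 (basisVec P j) = ψ.1 (basisVec P j)) : φ = ψ :=
  GrMod.hom_ext (LinearMap.pi_ext' fun j => LinearMap.ext_ring (h j))

/-- The map out of a graded free module with prescribed values on the basis. -/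
def freeModDesc {P : FreeData r} {N : X.GrMod} (y : P.ι → N.carrier)
    (hy : ∀ j, y j ∈ N.piece (-P.deg j)) : X.freeMod P ⟶ N :=
  ⟨Fintype.linearCombination X.S' y, fun d v hv => by
    refine AddSubgroup.sum_mem (N.piece d) fun j _ => ?_
    have := N.smul_mem (hv j trivial) (hy j)
    rwa [add_neg_cancel_right] at this⟩

theorem freeModDesc_basisVec {P : FreeData r} {N : X.GrMod} (y : P.ι → N.carrier)
    (hy : ∀ j, y j ∈ N.piece (-P.deg j)) (j : P.ι) :
    (freeModDesc y hy).1 (basisVec P j) = y j :=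
  (Fintype.linearCombination_apply_single X.S' y j 1).trans (one_smul _ _)

/-- A homogeneous element in the range of a map of graded modules has a homogeneous preimage. -/
theorem exists_homogeneous_preimage {M N : X.GrMod} (u : M ⟶ N) {d : Deg r} {y : N.carrier}
    (hy : y ∈ N.piece d) (h : ∃ x, u.1 x = y) : ∃ x ∈ M.piece d, u.1 x = y := by
  obtain ⟨π, h1, h2, h3, h4⟩ := exists_proj_of_isInternal _ M.isInternal
  obtain ⟨ρ, k1, k2, k3, k4⟩ := exists_proj_of_isInternal _ N.isInternal
  obtain ⟨x, rfl⟩ := h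
  refine ⟨π d x, h1 d x, ?_⟩
  obtain ⟨s, hs⟩ := h2 x
  rw [← k3 d _ hy]
  conv_rhs => rw [hs (insert d s) (Finset.subset_insert _ _), map_sum, map_sum]
  rw [Finset.sum_eq_single d]
  · exact (k3 _ _ (u.2 _ _ (h1 d x))).symm
  · intro e _ he
    exact k4 _ _ he _ (u.2 _ _ (h1 e x))
  · exact fun hd => absurd (Finset.mem_insert_self _ _) hd

/-- Graded free modules are projective. -/
theorem freeMod_lift {P : FreeData r} {M N N' : X.GrMod} (u : M ⟶ N) (v : N ⟶ N')
    (hex : ∀ y, v.1 y = 0 → ∃ x, u.1 x = y) (g : X.freeMod P ⟶ N) (hg : g ≫ v = 0) :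
    ∃ h : X.freeMod P ⟶ M, h ≫ u = g := by
  -- Each basis vector is lifted separately. The preimage can be chosen homogeneous of the same
  -- degree, so the resulting linear map preserves degrees.
  have key : ∀ j : P.ι, ∃ x ∈ M.piece (-P.deg j), u.1 x = g.1 (basisVec P j) :=
    fun j => exists_homogeneous_preimage u (g.2 _ _ (basisVec_mem_piece P j))
      (hex _ (by rw [← GrMod.comp_apply, hg, GrMod.zero_apply]))
  choose x hx hxu using key
  refine ⟨freeModDesc x hx, freeMod_hom_ext fun j => ?_⟩
  rw [GrMod.comp_apply, freeModDesc_basisVec, hxu]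

/-! ### Maps from bounded above complexes of free modules to acyclic complexes -/

variable (X) in
/-- Complexes of graded modules. -/
abbrev Cx : Type 1 := CochainComplex X.GrMod ℤ

/-- Exactness of the underlying complex of modules. -/
def IsExact (A : X.Cx) : Prop :=
  ∀ i j k : ℤ, i + 1 = j → j + 1 = k → ∀ y, (A.d j k).1 y = 0 → ∃ x, (A.d i j).1 x = y

/-- One step of the construction of a contraction. -/
theorem exists_homotopy_step {F A : X.Cx} {P : FreeData r} (hA : IsExact A) (f : F ⟶ A)
    {h i j m : ℤ} (hi : h + 1 = i) (hj : i + 1 = j) (e : F.X i ≅ X.freeMod P)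
    (k : F.X j ⟶ A.X i) (k' : F.X m ⟶ A.X j) (hk : f.f j = F.d j m ≫ k' + k ≫ A.d i j) :
    ∃ q : F.X i ⟶ A.X h, f.f i = F.d i j ≫ k + q ≫ A.d h i := by
  -- By `hk`, the error `f - d ≫ k` in degree `i` is killed by the differential of `A`. Exactness
  -- and projectivity then lift it through `A.d h i`.
  have h0 : (f.f i - F.d i j ≫ k) ≫ A.d i j = 0 := by
    rw [Preadditive.sub_comp, f.comm, hk, Preadditive.comp_add, ← Category.assoc, F.d_comp_d]
    simp
  obtain ⟨q, hq⟩ := freeMod_lift (A.d h i) (A.d i j) (hA h i j hi hj)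
    (e.inv ≫ (f.f i - F.d i j ≫ k)) (by rw [Category.assoc, h0, Limits.comp_zero])
  refine ⟨e.hom ≫ q, ?_⟩
  rw [Category.assoc, hq]
  simp

/-- The homotopy starts as zero above `b`, where `F` vanishes, and is extended downwards one degree
at a time by lifting from a projective. Stage `N` satisfies the homotopy identity in degrees `> b -
N`. Later stages do not change the components already used, so the stages glue. -/
theorem nullHomotopic_of_isExact {F A : X.Cx}
    (hF : ∀ i, ∃ P : FreeData r, Nonempty (F.X i ≅ X.freeMod P))
    {b : ℤ} (hb : F.IsStrictlyLE b) (hA : IsExact A) (f : F ⟶ A) :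
    Nonempty (Homotopy f 0) := by
  let good (N : ℕ) (H : ∀ i j, F.X i ⟶ A.X j) : Prop := ∀ i, b - N < i →
    f.f i = F.d i (i + 1) ≫ H (i + 1) i + H i (i - 1) ≫ A.d (i - 1) i
  have step : ∀ N (H : {H // good N H}), ∃ H' : {H // good (N + 1) H},
      ∀ i, b - N < i → H'.1 i = H.1 i := by
    rintro N ⟨H, hH⟩
    obtain ⟨P, ⟨e⟩⟩ := hF (b - N)
    obtain ⟨q, hq⟩ := exists_homotopy_step (h := b - N - 1) (j := b - N + 1) (m := b - N + 1 + 1)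
      hA f (by ring) rfl e (H _ _) (H _ _) (by
        have := hH (b - N + 1) (by lia)
        have e2 : b - N + 1 - 1 = b - N := by ring
        rwa [e2] at this)
    refine ⟨⟨Function.update H (b - N) (Function.update (H (b - N)) (b - N - 1) q), ?_⟩, ?_⟩
    · intro i hi
      by_cases h : i = b - N
      · subst h
        rw [Function.update_of_ne (by lia), Function.update_self, Function.update_self]
        exact hq
      · rw [Function.update_of_ne (by lia), Function.update_of_ne h]
        exact hH i (by push_cast at hi; lia)
    · intro i hi
      exact Function.update_of_ne (by lia) _ _
  choose next hnext using step
  let start : {H // good 0 H} := ⟨fun _ _ => 0, fun i hi =>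
    (F.isZero_of_isStrictlyLE b i (by simpa using hi)).eq_of_src _ _⟩
  let seq : ∀ N, {H // good N H} := fun N => Nat.rec start next N
  have stable : ∀ N M : ℕ, N ≤ M → ∀ i, b - N < i → (seq M).1 i = (seq N).1 i := by
    intro N M hNM
    induction M, hNM using Nat.le_induction with
    | base => exact fun _ _ => rfl
    | succ M hM ih =>
      intro i hi
      exact (hnext M (seq M) i (by lia)).trans (ih i hi)
  -- `(b - i + 1).toNat` is the first stage that is good in degree `i`; by `stable` every later
  -- stage has the same component out of `F.X i`.
  let T : ∀ i j, F.X i ⟶ A.X j := fun i j => if j + 1 = i then (seq (b - i + 1).toNat).1 i j else 0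
  have hT : ∀ i j, j + 1 = i → ∀ N : ℕ, b - N < i → T i j = (seq N).1 i j := by
    intro i j hij N hN
    simp only [T, if_pos hij]
    rw [stable (b - i + 1).toNat N (by lia) i (by lia)]
  refine ⟨⟨T, fun i j hij => if_neg hij, fun i => ?_⟩⟩
  rw [dNext_eq T (show (ComplexShape.up ℤ).Rel i (i + 1) from rfl),
    prevD_eq T (show (ComplexShape.up ℤ).Rel (i - 1) i from sub_add_cancel i 1)]
  rw [hT (i + 1) i rfl (b - i + 1).toNat (by lia),
    hT i (i - 1) (by ring) (b - i + 1).toNat (by lia)]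
  simpa using (seq (b - i + 1).toNat).2 i (by lia)

end SigmaModel

/-! ### Traces of graded matrices -/

section GradedTrace

variable {G ι κ : Type*} [Fintype ι] [Fintype κ]

open Classical in
/-- The trace of the part of degree `d` of a matrix whose rows and columns are graded by `p`. -/
def gradedTrace (p : ι → G) (d : G) (A : Matrix ι ι ℂ) : ℂ :=
  ∑ j, if p j = d then A j j else 0

theorem gradedTrace_add (p : ι → G) (d : G) (A B : Matrix ι ι ℂ) :
    gradedTrace p d (A + B) = gradedTrace p d A + gradedTrace p d B := by
  classical
  simp only [gradedTrace, ← Finset.sum_add_distrib]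
  refine Finset.sum_congr rfl fun j _ => ?_
  split_ifs <;> simp

/-- A product `A i j * B j i` with `A i j ≠ 0` has `q i = p j`, so it is counted on both sides or on
neither. Only one of the two matrices has to respect the grading. -/
theorem gradedTrace_mul_comm (p : ι → G) (q : κ → G) (d : G) (A : Matrix κ ι ℂ)
    (B : Matrix ι κ ℂ) (hA : ∀ i j, q i ≠ p j → A i j = 0) :
    gradedTrace p d (B * A) = gradedTrace q d (A * B) := by
  classical
  have h1 : gradedTrace p d (B * A) = ∑ j, ∑ i, if p j = d then B j i * A i j else 0 :=
    Finset.sum_congr rfl fun j _ => by split_ifs <;> simp [Matrix.mul_apply]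
  have h2 : gradedTrace q d (A * B) = ∑ i, ∑ j, if q i = d then A i j * B j i else 0 :=
    Finset.sum_congr rfl fun j _ => by split_ifs <;> simp [Matrix.mul_apply]
  rw [h1, h2, Finset.sum_comm]
  refine Finset.sum_congr rfl fun i _ => Finset.sum_congr rfl fun j _ => ?_
  by_cases h : q i = p j
  · rw [h, mul_comm]
  · simp [hA i j h]

theorem gradedTrace_one [DecidableEq ι] [DecidableEq G] (p : ι → G) (d : G) :
    gradedTrace p d (1 : Matrix ι ι ℂ) = Fintype.card {j // p j = d} := by
  rw [Fintype.card_subtype, gradedTrace, Finset.card_filter]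
  push_cast
  refine Finset.sum_congr rfl fun j _ => ?_
  simp

theorem gradedTrace_eq_zero [DecidableEq G] (p : ι → G) (d : G) (A : Matrix ι ι ℂ)
    (h : Fintype.card {j // p j = d} = 0) : gradedTrace p d A = 0 := by
  rw [Fintype.card_eq_zero_iff] at h
  exact Finset.sum_eq_zero fun j _ => if_neg fun hj => h.elim ⟨j, hj⟩

end GradedTrace

theorem linearMap_pi_apply {R ι κ : Type*} [CommRing R] [Fintype ι] [DecidableEq ι]
    (L : (ι → R) →ₗ[R] (κ → R)) (v : ι → R) (i : κ) :
    L v i = ∑ k, v k * L (Pi.single k 1) i := by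
  conv_lhs => rw [pi_eq_sum_univ' v, map_sum, Finset.sum_apply]
  refine Finset.sum_congr rfl fun k _ => ?_
  rw [map_smul, Pi.smul_apply, smul_eq_mul]

/-! ### Counting generators by degree -/

namespace FreeData

variable {r : ℕ}

/-- The number of summands `S(v){2m}` with `(v, m) = d`. -/
def count (P : FreeData r) (d : Deg r) : ℕ := Fintype.card {j : P.ι // P.deg j = d}

theorem count_shift (P : FreeData r) (e d : Deg r) : (P.shift e).count d = P.count (d - e) :=
  Fintype.card_congr (Equiv.subtypeEquivRight fun _ => eq_sub_iff_add_eq.symm)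

theorem count_sum (P Q : FreeData r) (d : Deg r) : (P.sum Q).count d = P.count d + Q.count d := by
  simp only [count, Fintype.card_subtype, Finset.card_filter]
  exact Fintype.sum_sum_type _

theorem count_eq_sum (P : FreeData r) (d : Deg r) :
    P.count d = ∑ j, if P.deg j = d then 1 else 0 := by
  simp only [count, Fintype.card_subtype, Finset.card_filter]

theorem finite_count_ne_zero (P : FreeData r) : {d | P.count d ≠ 0}.Finite := by
  refine (Set.finite_range P.deg).subset fun d hd => ?_
  obtain ⟨j⟩ := Fintype.card_pos_iff.1 (Nat.pos_of_ne_zero hd)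
  exact ⟨j.1, j.2⟩

end FreeData

namespace SigmaModel

variable {r n l : ℕ} {X : SigmaModel r n l}

/-! ### The fibre at the origin -/

/-- The constant monomial has degree `0` whatever the charges are. No positivity of the toric
grading is needed to reduce to the origin. -/
theorem constantCoeff_eq_zero {s : X.S} {d : Deg r} (hs : X.HomDeg s d) (hd : d ≠ 0) :
    MvPolynomial.constantCoeff s = 0 := by
  by_contra h
  have := hs (d := 0) h
  rw [map_zero] at this
  exact hd this.symm

theorem constantCoeff_W : MvPolynomial.constantCoeff X.W = 0 :=
  constantCoeff_eq_zero X.W_homDeg fun h => one_ne_zero (congrArg Prod.snd h)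

variable (X) in
/-- The value of a class in `S'` at the origin. -/
def evalOrigin : X.S' →+* ℂ :=
  Ideal.Quotient.lift (Ideal.span {X.W}) MvPolynomial.constantCoeff fun a ha => by
    obtain ⟨t, rfl⟩ := Ideal.mem_span_singleton'.1 ha
    rw [map_mul, constantCoeff_W, mul_zero]

theorem evalOrigin_eq_zero {s : X.S'} {d : Deg r} (hs : s ∈ X.pieceS' d) (hd : d ≠ 0) :
    X.evalOrigin s = 0 := by
  obtain ⟨t, ht, rfl⟩ := hs
  exact constantCoeff_eq_zero ht hd

theorem freeMod_hom_apply {P Q : FreeData r} (ψ : X.freeMod P ⟶ X.freeMod Q)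
    (v : P.ι → X.S') (i : Q.ι) :
    (ψ.1 v : Q.ι → X.S') i = ∑ k, v k * (ψ.1 (basisVec P k) : Q.ι → X.S') i :=
  linearMap_pi_apply ψ.1 v i

/-- The matrix of a map of graded free modules at the origin. -/
def originMatrix {P Q : FreeData r} (φ : X.freeMod P ⟶ X.freeMod Q) : Matrix Q.ι P.ι ℂ :=
  fun i j => X.evalOrigin ((φ.1 (basisVec P j) : Q.ι → X.S') i)

theorem originMatrix_comp {P Q T : FreeData r} (φ : X.freeMod P ⟶ X.freeMod Q)
    (ψ : X.freeMod Q ⟶ X.freeMod T) :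
    originMatrix (φ ≫ ψ) = originMatrix ψ * originMatrix φ := by
  ext i j
  rw [Matrix.mul_apply]
  refine (congrArg X.evalOrigin (freeMod_hom_apply ψ (φ.1 (basisVec P j)) i)).trans ?_
  rw [map_sum]
  refine Finset.sum_congr rfl fun k _ => ?_
  rw [map_mul, mul_comm]
  rfl

theorem originMatrix_add {P Q : FreeData r} (φ ψ : X.freeMod P ⟶ X.freeMod Q) :
    originMatrix (φ + ψ) = originMatrix φ + originMatrix ψ := by
  ext i j
  exact map_add X.evalOrigin _ _

theorem originMatrix_zero {P Q : FreeData r} :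
    originMatrix (0 : X.freeMod P ⟶ X.freeMod Q) = 0 := by
  ext i j
  exact map_zero X.evalOrigin

theorem originMatrix_id (P : FreeData r) : originMatrix (𝟙 (X.freeMod P)) = 1 := by
  ext i j
  change X.evalOrigin ((Pi.single j 1 : P.ι → X.S') i) = _
  by_cases h : i = j
  · subst h
    simp
  · simp [h]

/-- The entry `(i, j)` is homogeneous of degree `Q.deg i - P.deg j`, so at the origin only
generators of equal degree can interact. -/
theorem originMatrix_eq_zero {P Q : FreeData r} (φ : X.freeMod P ⟶ X.freeMod Q) (i : Q.ι) (j : P.ι)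
    (h : Q.deg i ≠ P.deg j) : originMatrix φ i j = 0 := by
  refine evalOrigin_eq_zero (φ.2 _ _ (basisVec_mem_piece P j) i trivial) fun e => h ?_
  rwa [neg_add_eq_zero, eq_comm] at e

/-! ### Bounded above complexes of graded free modules -/

variable (X) in
/-- A bounded above complex of graded free modules of finite rank. -/
structure FreeCx where
  /-- the complex -/
  F : X.Cx
  /-- the degrees of the generators of `F^i` -/
  gens : ℤ → FreeData r
  /-- a homogeneous basis of `F^i` -/
  basis : ∀ i, F.X i ≅ X.freeMod (gens i)
  bounded : ∃ b : ℤ, F.IsStrictlyLE b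

namespace FreeCx

/-- Every degree occurs in finitely many terms of the complex. -/
def Summable (C : X.FreeCx) : Prop := ∀ d, {i : ℤ | (C.gens i).count d ≠ 0}.Finite

/-- The alternating sum of the numbers of generators of a given degree. -/
def euler (C : X.FreeCx) (d : Deg r) : ℤ := ∑ᶠ i : ℤ, (i.negOnePow : ℤ) * ((C.gens i).count d : ℤ)

/-- The matrix at the origin of a map between terms of a complex of free modules. -/
def mat (C : X.FreeCx) {i j : ℤ} (φ : C.F.X i ⟶ C.F.X j) : Matrix (C.gens j).ι (C.gens i).ι ℂ :=
  originMatrix ((C.basis i).inv ≫ φ ≫ (C.basis j).hom)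

theorem mat_comp (C : X.FreeCx) {i j k : ℤ} (φ : C.F.X i ⟶ C.F.X j) (ψ : C.F.X j ⟶ C.F.X k) :
    C.mat (φ ≫ ψ) = C.mat ψ * C.mat φ := by
  rw [mat, mat, mat, ← originMatrix_comp]
  simp

theorem mat_add (C : X.FreeCx) {i j : ℤ} (φ ψ : C.F.X i ⟶ C.F.X j) :
    C.mat (φ + ψ) = C.mat φ + C.mat ψ := by
  rw [mat, mat, mat, ← originMatrix_add]
  simp

theorem mat_id (C : X.FreeCx) (i : ℤ) : C.mat (𝟙 (C.F.X i)) = 1 := by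
  rw [mat, ← originMatrix_id (X := X)]
  simp

/-- The generators are separate data, so they have to be recovered from the term: the graded trace
of the identity at the origin counts them, and on a zero object the identity is zero. -/
theorem count_eq_zero_of_isZero (C : X.FreeCx) {i : ℤ} (h : Limits.IsZero (C.F.X i)) (d : Deg r) :
    (C.gens i).count d = 0 := by
  have h1 : gradedTrace (C.gens i).deg d (C.mat (𝟙 (C.F.X i))) = 0 := by
    rw [h.eq_of_src (𝟙 _) 0, mat]
    simp [originMatrix_zero, gradedTrace]
  rw [mat_id, gradedTrace_one] at h1
  exact_mod_cast h1

/-- The Euler characteristic of a contractible complex vanishes. -/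
theorem euler_eq_zero (C : X.FreeCx) (hs : C.Summable) (h : Homotopy (𝟙 C.F) 0) : C.euler = 0 := by
  funext d
  let t : ℤ → ℂ := fun i => gradedTrace (C.gens i).deg d (C.mat (C.F.d i (i + 1) ≫ h.hom (i + 1) i))
  have ht : ∀ i, (C.gens i).count d = 0 → t i = 0 := fun i hi => gradedTrace_eq_zero _ _ _ hi
  -- The identity is the sum of two compositions through the neighbouring terms. Cyclicity turns the
  -- trace of the second one on `F^i` into the trace `t (i - 1)` on `F^(i-1)`.
  have key : ∀ i, ((C.gens i).count d : ℂ) = t i + t (i - 1) := by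
    intro i
    have h1 := h.comm i
    rw [dNext_eq h.hom (show (ComplexShape.up ℤ).Rel i (i + 1) from rfl),
      prevD_eq h.hom (show (ComplexShape.up ℤ).Rel (i - 1) i from sub_add_cancel i 1)] at h1
    have h2 : (1 : Matrix _ _ ℂ) = C.mat (C.F.d i (i + 1) ≫ h.hom (i + 1) i) +
        C.mat (h.hom i (i - 1) ≫ C.F.d (i - 1) i) := by
      rw [← mat_add, ← mat_id]
      simpa using congrArg C.mat h1
    have h3 : gradedTrace (C.gens i).deg d (C.mat (h.hom i (i - 1) ≫ C.F.d (i - 1) i)) =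
        t (i - 1) := by
      simp only [t]
      rw [sub_add_cancel, mat_comp, mat_comp]
      exact gradedTrace_mul_comm _ _ _ _ _ fun a b hab => originMatrix_eq_zero _ _ _ hab
    rw [FreeData.count, ← gradedTrace_one, h2, gradedTrace_add, h3]
  have hfin : (Function.support fun i : ℤ => ((i.negOnePow : ℤ) : ℂ) * t i).Finite :=
    (hs d).subset fun i hi h0 => hi (by simp [ht i h0])
  have h4 : ((C.euler d : ℤ) : ℂ) =
      ∑ᶠ i : ℤ, ((i.negOnePow : ℤ) : ℂ) * ((C.gens i).count d : ℂ) := by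
    rw [euler]
    refine ((Int.castAddHom ℂ).map_finsum ?_).trans ?_
    rotate_left
    · simp
    · exact (hs d).subset fun i hi h0 => hi (by simp [h0])
  -- With signs, the summand is a difference of consecutive values of one finitely supported
  -- function, so the total vanishes after reindexing.
  have h5 : ∀ i : ℤ, ((i.negOnePow : ℤ) : ℂ) * ((C.gens i).count d : ℂ) =
      ((i.negOnePow : ℤ) : ℂ) * t i - (((i - 1).negOnePow : ℤ) : ℂ) * t (i - 1) := by
    intro i
    rw [key, Int.negOnePow_sub]
    push_cast
    simp
    ring
  have hfin' :
      (Function.support fun i : ℤ => (((i - 1).negOnePow : ℤ) : ℂ) * t (i - 1)).Finite := by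
    refine (hfin.image (· + 1)).subset fun i hi => ⟨i - 1, hi, sub_add_cancel i 1⟩
  have h6 : ∑ᶠ i : ℤ, (((i - 1).negOnePow : ℤ) : ℂ) * t (i - 1) =
      ∑ᶠ i : ℤ, ((i.negOnePow : ℤ) : ℂ) * t i :=
    finsum_comp_equiv (Equiv.subRight (1 : ℤ)) (f := fun i : ℤ => ((i.negOnePow : ℤ) : ℂ) * t i)
  have h7 : ((C.euler d : ℤ) : ℂ) = 0 := by
    rw [h4, finsum_congr h5, finsum_sub_distrib hfin hfin', h6, sub_self]
  exact_mod_cast h7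

end FreeCx

/-! ### The homotopy category and the derived category -/

instance : HasDerivedCategory (ModuleCat.{0} X.S') := HasDerivedCategory.standard _

variable (X) in
/-- The homotopy category of complexes of graded modules. -/
abbrev KH : Type 1 := HomotopyCategory X.GrMod (ComplexShape.up ℤ)

variable (X) in
/-- The projection to the homotopy category. -/
abbrev toK : X.Cx ⥤ X.KH := HomotopyCategory.quotient X.GrMod (ComplexShape.up ℤ)

variable (X) in
/-- The passage to the derived category of ungraded modules. -/
abbrev toD : X.KH ⥤ DerivedCategory (ModuleCat.{0} X.S') :=
  (forgetGrading X).mapHomotopyCategory (ComplexShape.up ℤ) ⋙ DerivedCategory.Qh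

/-- Quasi-isomorphisms are tested after forgetting the grading. The functor from the graded homotopy
category to the ungraded derived category is triangulated, so graded triangles can be compared
there. -/
theorem isQis_iff {K L : X.Cx} (φ : K ⟶ L) : IsQis φ ↔ IsIso (X.toD.map (X.toK.map φ)) :=
  (DerivedCategory.isIso_Q_map_iff_quasiIso _
    (((forgetGrading X).mapHomologicalComplex (ComplexShape.up ℤ)).map φ)).symm

/-- On an object that vanishes in the derived category the zero map is a quasi-isomorphism; on
homology it induces a map that is both zero and mono. -/
theorem isExact_of_isZero {A : X.Cx} (h : Limits.IsZero (X.toD.obj (X.toK.obj A))) :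
    IsExact A := by
  intro i j k hi hj y hy
  have h1 : QuasiIso (0 : ((forgetGrading X).mapHomologicalComplex (ComplexShape.up ℤ)).obj A ⟶
      ((forgetGrading X).mapHomologicalComplex (ComplexShape.up ℤ)).obj A) := by
    rw [← DerivedCategory.isIso_Q_map_iff_quasiIso]
    refine ⟨0, ?_, ?_⟩ <;> exact Limits.IsZero.eq_of_src h _ _
  have h2 : (((forgetGrading X).mapHomologicalComplex (ComplexShape.up ℤ)).obj A).ExactAt j := by
    rw [HomologicalComplex.exactAt_iff_isZero_homology, Limits.IsZero.iff_id_eq_zero,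
      ← cancel_mono (HomologicalComplex.homologyMap (0 :
        ((forgetGrading X).mapHomologicalComplex (ComplexShape.up ℤ)).obj A ⟶
        ((forgetGrading X).mapHomologicalComplex (ComplexShape.up ℤ)).obj A) j)]
    simp
  rw [HomologicalComplex.exactAt_iff' _ i j k (by simp [← hi]) (by simp [hj]),
    ShortComplex.moduleCat_exact_iff] at h2
  exact h2 y hy

/-- Bounded above complexes of free modules are K-projective: morphisms to acyclic objects of the
homotopy category vanish. -/
theorem FreeCx.eq_zero_of_isZero (C : X.FreeCx) {N : X.KH} (h : Limits.IsZero (X.toD.obj N))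
    (f : X.toK.obj C.F ⟶ N) : f = 0 := by
  obtain ⟨A, rfl⟩ := HomotopyCategory.quotient_obj_surjective N
  obtain ⟨f, rfl⟩ := X.toK.map_surjective f
  obtain ⟨b, hb⟩ := C.bounded
  obtain ⟨H⟩ := nullHomotopic_of_isExact (fun i => ⟨_, ⟨C.basis i⟩⟩) hb (isExact_of_isZero h) f
  rw [HomotopyCategory.eq_of_homotopy f 0 H, Functor.map_zero]

/-- Maps from bounded above complexes of free modules lift along quasi-isomorphisms. -/
theorem FreeCx.exists_lift (C : X.FreeCx) {M N : X.KH} (s : M ⟶ N) (hs : IsIso (X.toD.map s))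
    (f : X.toK.obj C.F ⟶ N) : ∃ g : X.toK.obj C.F ⟶ M, f = g ≫ s := by
  -- The cone `Z` of `s` is acyclic, so `f` dies in it and therefore factors through `s`.
  obtain ⟨Z, g, h, hT⟩ := Pretriangulated.distinguished_cocone_triangle s
  have hZ : Limits.IsZero (X.toD.obj Z) :=
    (Pretriangulated.Triangle.isZero₃_iff_isIso₁ _ (X.toD.map_distinguished _ hT)).2 hs
  exact Pretriangulated.Triangle.coyoneda_exact₂ _ hT f (C.eq_zero_of_isZero hZ _)

/-! ### Shifts and cones of complexes of free modules -/

namespace FreeCx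

/-- The shift of a complex of free modules. -/
def shift (C : X.FreeCx) (a : ℤ) : X.FreeCx where
  F := C.F⟦a⟧
  gens i := C.gens (i + a)
  basis i := C.basis (i + a)
  bounded := by
    obtain ⟨b, hb⟩ := C.bounded
    refine ⟨b - a, (CochainComplex.isStrictlyLE_iff _ _).2 fun i hi => ?_⟩
    exact C.F.isZero_of_isStrictlyLE b (i + a) (by lia)

theorem Summable.shift {C : X.FreeCx} (hC : C.Summable) (a : ℤ) : (C.shift a).Summable :=
  fun d => (hC d).preimage (add_left_injective a).injOn

theorem euler_shift (C : X.FreeCx) : (C.shift (-1)).euler = -C.euler := by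
  funext d
  have h := finsum_comp_equiv (Equiv.addRight (-1 : ℤ))
    (f := fun i : ℤ => (i.negOnePow : ℤ) * ((C.gens i).count d : ℤ))
  rw [Pi.neg_apply, euler, euler, ← h, ← finsum_neg_distrib]
  refine finsum_congr fun i => ?_
  simp [shift, ← sub_eq_add_neg, Int.negOnePow_sub]

/-- The inclusion of the first summand. -/
def sumInl (P Q : FreeData r) : X.freeMod P ⟶ X.freeMod (P.sum Q) :=
  freeModDesc (fun j => basisVec (P.sum Q) (Sum.inl j))
    fun j => basisVec_mem_piece (P.sum Q) (Sum.inl j)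

/-- The inclusion of the second summand. -/
def sumInr (P Q : FreeData r) : X.freeMod Q ⟶ X.freeMod (P.sum Q) :=
  freeModDesc (fun j => basisVec (P.sum Q) (Sum.inr j))
    fun j => basisVec_mem_piece (P.sum Q) (Sum.inr j)

/-- The map out of a sum with prescribed components. -/
def sumDesc {P Q : FreeData r} {N : X.GrMod} (φ : X.freeMod P ⟶ N) (ψ : X.freeMod Q ⟶ N) :
    X.freeMod (P.sum Q) ⟶ N :=
  freeModDesc (P := P.sum Q)
    (Sum.elim (fun j => φ.1 (basisVec P j)) (fun j => ψ.1 (basisVec Q j))) (by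
      rintro (j | j)
      · exact φ.2 _ _ (basisVec_mem_piece P j)
      · exact ψ.2 _ _ (basisVec_mem_piece Q j))

theorem sumInl_desc {P Q : FreeData r} {N : X.GrMod} (φ : X.freeMod P ⟶ N)
    (ψ : X.freeMod Q ⟶ N) : sumInl P Q ≫ sumDesc φ ψ = φ :=
  freeMod_hom_ext fun j => (congrArg (sumDesc φ ψ).1 (freeModDesc_basisVec _ _ j)).trans
    (freeModDesc_basisVec (P := P.sum Q) _ _ (Sum.inl j))

theorem sumInr_desc {P Q : FreeData r} {N : X.GrMod} (φ : X.freeMod P ⟶ N)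
    (ψ : X.freeMod Q ⟶ N) : sumInr P Q ≫ sumDesc φ ψ = ψ :=
  freeMod_hom_ext fun j => (congrArg (sumDesc φ ψ).1 (freeModDesc_basisVec _ _ j)).trans
    (freeModDesc_basisVec (P := P.sum Q) _ _ (Sum.inr j))

theorem sum_hom_ext {P Q : FreeData r} {N : X.GrMod} {φ ψ : X.freeMod (P.sum Q) ⟶ N}
    (h₁ : sumInl P Q ≫ φ = sumInl P Q ≫ ψ) (h₂ : sumInr P Q ≫ φ = sumInr P Q ≫ ψ) : φ = ψ := by
  have e₁ : ∀ j, (sumInl P Q : X.freeMod P ⟶ _).1 (basisVec P j) = basisVec (P.sum Q) (Sum.inl j) :=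
    fun j => freeModDesc_basisVec _ _ j
  have e₂ : ∀ j, (sumInr P Q : X.freeMod Q ⟶ _).1 (basisVec Q j) = basisVec (P.sum Q) (Sum.inr j) :=
    fun j => freeModDesc_basisVec _ _ j
  refine freeMod_hom_ext ?_
  rintro (j | j)
  · rw [← e₁, ← GrMod.comp_apply, h₁, GrMod.comp_apply]
  · rw [← e₂, ← GrMod.comp_apply, h₂, GrMod.comp_apply]

/-- The sum of graded free modules is a biproduct. -/
def sumIso (P Q : FreeData r) : X.freeMod P ⊞ X.freeMod Q ≅ X.freeMod (P.sum Q) where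
  hom := Limits.biprod.desc (sumInl P Q) (sumInr P Q)
  inv := sumDesc Limits.biprod.inl Limits.biprod.inr
  hom_inv_id := Limits.biprod.hom_ext' _ _ (by simp [sumInl_desc]) (by simp [sumInr_desc])
  inv_hom_id := sum_hom_ext
    (by rw [← Category.assoc, sumInl_desc, Limits.biprod.inl_desc, Category.comp_id])
    (by rw [← Category.assoc, sumInr_desc, Limits.biprod.inr_desc, Category.comp_id])

/-- The terms of a mapping cone. -/
def coneXIso {K L : X.Cx} (φ : K ⟶ L) (i : ℤ) :
    (CochainComplex.mappingCone φ).X i ≅ K.X (i + 1) ⊞ L.X i :=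
  HomologicalComplex.homotopyCofiber.XIsoBiprod φ i (i + 1) rfl

/-- The mapping cone of a map of complexes of free modules. -/
def cone {C D : X.FreeCx} (φ : C.F ⟶ D.F) : X.FreeCx where
  F := CochainComplex.mappingCone φ
  gens i := (C.gens (i + 1)).sum (D.gens i)
  basis i := coneXIso φ i ≪≫ Limits.biprod.mapIso (C.basis (i + 1)) (D.basis i) ≪≫ sumIso _ _
  bounded := by
    obtain ⟨b, hb⟩ := C.bounded
    obtain ⟨c, hc⟩ := D.bounded
    refine ⟨max b c, (CochainComplex.isStrictlyLE_iff _ _).2 fun i hi => ?_⟩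
    refine Limits.IsZero.of_iso ?_ (coneXIso φ i)
    rw [Limits.biprod_isZero_iff]
    exact ⟨C.F.isZero_of_isStrictlyLE b _ (by lia), D.F.isZero_of_isStrictlyLE c _ (by lia)⟩

theorem Summable.cone {C D : X.FreeCx} (hC : C.Summable) (hD : D.Summable) (φ : C.F ⟶ D.F) :
    (FreeCx.cone φ).Summable := by
  intro d
  refine ((hC.shift 1 d).union (hD d)).subset fun i hi => ?_
  by_contra h
  rw [Set.mem_union, not_or] at h
  refine hi ((FreeData.count_sum _ _ d).trans ?_)
  rw [not_not.1 h.2, add_zero]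
  exact not_not.1 h.1

theorem finite_support {C : X.FreeCx} (hC : C.Summable) (d : Deg r) :
    (Function.support fun i : ℤ => (i.negOnePow : ℤ) * ((C.gens i).count d : ℤ)).Finite :=
  (hC d).subset fun i hi h0 => hi (by simp [h0])

theorem euler_cone {C D : X.FreeCx} (hC : C.Summable) (hD : D.Summable) (φ : C.F ⟶ D.F) :
    (cone φ).euler = D.euler - C.euler := by
  funext d
  have h := finsum_comp_equiv (Equiv.addRight (1 : ℤ))
    (f := fun i : ℤ => (i.negOnePow : ℤ) * ((C.gens i).count d : ℤ))
  rw [Pi.sub_apply, euler, euler, euler, ← h, ← finsum_sub_distrib (finite_support hD d)]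
  · refine finsum_congr fun i => ?_
    simp only [cone, FreeData.count_sum, Equiv.coe_addRight, Int.negOnePow_succ]
    push_cast
    ring
  · exact (finite_support hC d).preimage (Equiv.addRight (1 : ℤ)).injective.injOn

end FreeCx

/-! ### Resolutions in the homotopy category -/

/-- `N` has a summable free resolution whose Euler characteristic is `e`. -/
def HasRes (N : X.KH) (e : Deg r → ℤ) : Prop :=
  ∃ C : X.FreeCx, C.Summable ∧ C.euler = e ∧
    ∃ f : X.toK.obj C.F ⟶ N, IsIso (X.toD.map f)

namespace HasRes

theorem shift {N : X.KH} {e : Deg r → ℤ} (h : HasRes N e) : HasRes (N⟦(-1 : ℤ)⟧) (-e) := by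
  obtain ⟨C, hC, rfl, f, hf⟩ := h
  have h1 : IsIso (X.toD.map (f⟦(-1 : ℤ)⟧')) :=
    (NatIso.isIso_map_iff (X.toD.commShiftIso (-1 : ℤ)) f).2
      (inferInstanceAs (IsIso ((X.toD.map f)⟦(-1 : ℤ)⟧')))
  have h2 : IsIso (X.toD.map ((X.toK.commShiftIso (-1 : ℤ)).hom.app C.F ≫ f⟦(-1 : ℤ)⟧')) := by
    rw [Functor.map_comp]
    infer_instance
  exact ⟨C.shift (-1), hC.shift _, C.euler_shift, _, h2⟩

open Pretriangulated in
-- The first map of the triangle lifts to a map of resolutions. The cone of the lift resolves the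
-- third object by the five lemma in the derived category, and Euler characteristics subtract on
-- cones.
theorem triangle {T : Triangle X.KH} (hT : T ∈ distTriang X.KH) {e₁ e₂ : Deg r → ℤ}
    (h₁ : HasRes T.obj₁ e₁) (h₂ : HasRes T.obj₂ e₂) : HasRes T.obj₃ (e₂ - e₁) := by
  obtain ⟨C, hC, rfl, f, hf⟩ := h₁
  obtain ⟨D, hD, rfl, g, hg⟩ := h₂
  obtain ⟨φ, hφ⟩ := C.exists_lift g hg (f ≫ T.mor₁)
  obtain ⟨φ, rfl⟩ := X.toK.map_surjective φ
  have hT' := HomotopyCategory.mappingCone_triangleh_distinguished φ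
  obtain ⟨c, hc₁, hc₂⟩ := complete_distinguished_triangle_morphism _ _ hT' hT f g hφ.symm
  refine ⟨FreeCx.cone φ, hC.cone hD φ, FreeCx.euler_cone hC hD φ, c, ?_⟩
  let α : CochainComplex.mappingCone.triangleh φ ⟶ T := Triangle.homMk _ _ f g c hφ.symm hc₁ hc₂
  exact isIso₃_of_isIso₁₂ (X.toD.mapTriangle.map α)
    (X.toD.map_distinguished _ hT') (X.toD.map_distinguished _ hT) hf hg

open Pretriangulated in
-- A comparison map `φ` over `N` becomes invertible in the derived category, so its cone is acyclic.
-- Being bounded above and free, the cone is contractible, and its Euler characteristic `D.euler -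
-- C.euler` is zero.
theorem unique {N : X.KH} {C D : X.FreeCx} (hC : C.Summable) (hD : D.Summable)
    (f : X.toK.obj C.F ⟶ N) (hf : IsIso (X.toD.map f))
    (g : X.toK.obj D.F ⟶ N) (hg : IsIso (X.toD.map g)) : C.euler = D.euler := by
  obtain ⟨φ, rfl⟩ := C.exists_lift g hg f
  obtain ⟨φ, rfl⟩ := X.toK.map_surjective φ
  rw [Functor.map_comp] at hf
  have hφ := IsIso.of_isIso_comp_right (X.toD.map (X.toK.map φ)) (X.toD.map g)
  have hZ : Limits.IsZero (X.toD.obj (X.toK.obj (FreeCx.cone φ).F)) :=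
    (Triangle.isZero₃_iff_isIso₁ _ (X.toD.map_distinguished _
      (HomotopyCategory.mappingCone_triangleh_distinguished φ))).2 hφ
  -- The identity of the cone is itself a map from a free complex to an acyclic one.
  have h0 := (FreeCx.cone φ).eq_zero_of_isZero hZ (X.toK.map (𝟙 _))
  have h1 := FreeCx.euler_eq_zero (FreeCx.cone φ) (hC.cone hD φ)
    (HomotopyCategory.homotopyOfEq _ _ (h0.trans (Functor.map_zero _ _ _).symm))
  rw [FreeCx.euler_cone hC hD, sub_eq_zero] at h1
  exact h1.symm

end HasRes

/-! ### Resolutions modulo perfect complexes -/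

/-- Only finitely many terms of finite rank contribute, so the class of a perfect complex is a
Laurent polynomial. -/
theorem HasRes.of_perfect {K : X.Cx} (hK : Perfect K) :
    ∃ e : Deg r → ℤ, (Function.support e).Finite ∧ HasRes (X.toK.obj K) e := by
  obtain ⟨L, φ, ⟨a, b, ha, hb⟩, hL, hφ⟩ := hK
  choose P hP using hL
  let C : X.FreeCx := ⟨L, P, fun i => (hP i).some, b, hb⟩
  have h0 : ∀ i, i ∉ Set.Icc a b → ∀ d, (C.gens i).count d = 0 := by
    intro i hi d
    refine C.count_eq_zero_of_isZero ?_ d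
    rw [Set.mem_Icc, not_and_or, not_le, not_le] at hi
    exact hi.elim (fun h => L.isZero_of_isStrictlyGE a i h) fun h => L.isZero_of_isStrictlyLE b i h
  refine ⟨C.euler, ?_, C, fun d => (Set.finite_Icc a b).subset fun i hi => ?_, rfl, X.toK.map φ,
    (isQis_iff φ).1 hφ⟩
  · refine ((Set.finite_Icc a b).biUnion fun i _ => (C.gens i).finite_count_ne_zero).subset ?_
    intro d hd
    obtain ⟨i, h1⟩ : ∃ i, (C.gens i).count d ≠ 0 := by
      by_contra! h
      exact hd (finsum_eq_zero_of_forall_eq_zero fun i => by simp [h])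
    exact Set.mem_biUnion (not_imp_comm.1 (h0 i · d) h1) h1
  · exact not_imp_comm.1 (h0 i · d) hi

open Pretriangulated in
-- One inverse rotation of the cone triangle gives `cone[-1] → Z → M`, which changes the Euler
-- characteristic by that of the perfect cone.
theorem HasRes.target_of_perfect_cone {Z M : X.Cx} (φ : Z ⟶ M)
    (hφ : Perfect (CochainComplex.mappingCone φ)) {e : Deg r → ℤ}
    (h : HasRes (X.toK.obj Z) e) :
    ∃ e' : Deg r → ℤ, (Function.support (e' - e)).Finite ∧ HasRes (X.toK.obj M) e' := by
  obtain ⟨c, hc, hC⟩ := HasRes.of_perfect hφ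
  have hT := HomotopyCategory.mappingCone_triangleh_distinguished φ
  refine ⟨e - -c, by simpa using hc, HasRes.triangle (inv_rot_of_distTriang _ hT) hC.shift h⟩

open Pretriangulated in
-- Two inverse rotations give `M[-1] → cone[-1] → Z`, so `Z` appears as a third object whose two
-- predecessors are already resolved.
theorem HasRes.source_of_perfect_cone {Z M : X.Cx} (φ : Z ⟶ M)
    (hφ : Perfect (CochainComplex.mappingCone φ)) {e : Deg r → ℤ}
    (h : HasRes (X.toK.obj M) e) :
    ∃ e' : Deg r → ℤ, (Function.support (e' - e)).Finite ∧ HasRes (X.toK.obj Z) e' := by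
  obtain ⟨c, hc, hC⟩ := HasRes.of_perfect hφ
  have hT := HomotopyCategory.mappingCone_triangleh_distinguished φ
  refine ⟨-c - -e, by simpa using hc, HasRes.triangle
    (inv_rot_of_distTriang _ (inv_rot_of_distTriang _ hT)) h.shift hC.shift⟩

theorem HasRes.of_isoModPerf {M N : X.Cx} (hMN : IsoModPerf M N) {e : Deg r → ℤ}
    (h : HasRes (X.toK.obj N) e) :
    ∃ e' : Deg r → ℤ, (Function.support (e' - e)).Finite ∧ HasRes (X.toK.obj M) e' := by
  obtain ⟨Z, φ, ψ, -, hφ, hψ⟩ := hMN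
  obtain ⟨e₁, h₁, hZ⟩ := HasRes.source_of_perfect_cone ψ hψ h
  obtain ⟨e₂, h₂, hM⟩ := HasRes.target_of_perfect_cone φ hφ hZ
  refine ⟨e₂, (h₂.union h₁).subset ?_, hM⟩
  rw [← sub_add_sub_cancel e₂ e₁ e]
  exact Function.support_add _ _

/-! ### Comparison with resolutions of complexes -/

/-- The formal series whose coefficient of `s^v σ^{-2m}` is `e (v, m)`. -/
def formalSeries (e : Deg r → ℤ) : FormalSeries r := fun v k =>
  ∑ᶠ (m : ℤ) (_ : k = -(2 * m)), e (v, m)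

theorem formalSeries_even (e : Deg r → ℤ) (v : Fin r → ℤ) (m : ℤ) :
    formalSeries e v (-(2 * m)) = e (v, m) := by
  rw [formalSeries, finsum_eq_single _ m]
  · simp
  · intro m' hm'
    have : ¬ -(2 * m) = -(2 * m') := by lia
    simp [this]

theorem formalSeries_odd (e : Deg r → ℤ) (v : Fin r → ℤ) {k : ℤ} (hk : Odd k) :
    formalSeries e v k = 0 := by
  refine finsum_eq_zero_of_forall_eq_zero fun m => ?_
  have : ¬ k = -(2 * m) := by
    obtain ⟨j, hj⟩ := hk
    lia
  simp [this]

/-- The complex of free modules of a resolution. -/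
def FreeResolution.toFreeCx {M : X.Cx} (R : FreeResolution M) : X.FreeCx :=
  ⟨R.F, R.gens, R.basis, R.bounded⟩

theorem FreeResolution.series_eq {M : X.Cx} (R : FreeResolution M) :
    R.series = formalSeries R.toFreeCx.euler := rfl

theorem HasRes.exists_freeResolution {M : X.Cx} {e : Deg r → ℤ} (h : HasRes (X.toK.obj M) e) :
    ∃ R : FreeResolution M, R.Summable ∧ R.series = formalSeries e := by
  obtain ⟨C, hC, rfl, f, hf⟩ := h
  obtain ⟨f, rfl⟩ := X.toK.map_surjective f
  exact ⟨⟨C.F, C.gens, C.basis, C.bounded, f, (isQis_iff f).2 hf⟩, fun v m => hC (v, m), rfl⟩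

theorem HasRes.series_eq {M : X.Cx} {e : Deg r → ℤ} (h : HasRes (X.toK.obj M) e)
    (R : FreeResolution M) (hR : R.Summable) : R.series = formalSeries e := by
  obtain ⟨C, hC, rfl, f, hf⟩ := h
  rw [R.series_eq, HasRes.unique (C := R.toFreeCx) (fun d => hR d.1 d.2) hC (X.toK.map R.aug)
    ((isQis_iff _).1 R.isQis) f hf]

/-! ### The periodic resolution of the cokernel of a matrix factorization -/

/-- The inverse shift `P[-1] = (P₀{-2} ⇄ P₁)`. -/
@[reducible]
def MF.unshift (a : X.MF) : X.MF where
  P₁ := a.P₀.shift (-degW r)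
  P₀ := a.P₁
  u₁ := a.u₀
  u₀ := a.u₁
  deg_u₁ := fun i j => (a.deg_u₀ i j).of_eq (by
    change a.P₁.deg i - a.P₀.deg j + degW r = a.P₁.deg i - (a.P₀.deg j + -degW r) + 0
    abel)
  deg_u₀ := fun i j => (a.deg_u₁ i j).of_eq (by
    change a.P₀.deg i - a.P₁.deg j + 0 = a.P₀.deg i + -degW r - a.P₁.deg j + degW r
    abel)
  u₀_u₁ := a.u₁_u₀
  u₁_u₀ := a.u₀_u₁

/-- The iterated inverse shifts `P[-k]`. -/
def MF.unshiftIter (a : X.MF) : ℕ → X.MF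
  | 0 => a
  | k + 1 => (a.unshiftIter k).unshift

theorem MF.unshift_u₁'_comp (a : X.MF) : a.unshift.u₁' ≫ a.u₁' = 0 := by
  refine GrMod.hom_ext (LinearMap.ext fun v : a.P₀.ι → X.S' => ?_)
  change (a.u₁.map (Ideal.Quotient.mk (Ideal.span {X.W}))).mulVec
    ((a.u₀.map (Ideal.Quotient.mk (Ideal.span {X.W}))).mulVec v) = 0
  have hW : Ideal.Quotient.mk (Ideal.span {X.W}) X.W = 0 :=
    Ideal.Quotient.eq_zero_iff_mem.2 (Ideal.mem_span_singleton_self _)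
  rw [Matrix.mulVec_mulVec, ← Matrix.map_mul, a.u₁_u₀]
  have : (X.W • (1 : Matrix a.P₀.ι a.P₀.ι X.S)).map (Ideal.Quotient.mk (Ideal.span {X.W})) = 0 := by
    ext i j
    simp [hW]
  rw [this, Matrix.zero_mulVec]

/-- Lift `y` to `Y` over `S`. Then `u₁ Y = W w`, and applying `u₀` gives `W Y = W u₀ w`, so `Y = u₀
w` because `S` is a domain. The hypothesis `W ≠ 0` is needed only for this cancellation. -/
theorem MF.exact_u₁' (hW : X.W ≠ 0) (a : X.MF) (y : (X.freeMod a.P₁).carrier)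
    (hy : a.u₁'.1 y = 0) : ∃ x, a.unshift.u₁'.1 x = y := by
  set π := Ideal.Quotient.mk (Ideal.span {X.W}) with hπ
  obtain ⟨Y, hY⟩ : ∃ Y : a.P₁.ι → X.S, π ∘ Y = y := by
    choose Y hY using fun i => Ideal.Quotient.mk_surjective ((y : a.P₁.ι → X.S') i)
    exact ⟨Y, funext hY⟩
  subst hY
  have h1 : ∀ i, ∃ w, w * X.W = a.u₁.mulVec Y i := by
    intro i
    refine Ideal.mem_span_singleton'.1 (Ideal.Quotient.eq_zero_iff_mem.1 ?_)
    refine Eq.trans ?_ (congrFun hy i)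
    exact RingHom.map_mulVec π a.u₁ Y i
  choose w hw using h1
  have h2 : a.u₁.mulVec Y = X.W • w := funext fun i => by
    rw [← hw, Pi.smul_apply, smul_eq_mul, mul_comm]
  have h3 : X.W • Y = X.W • a.u₀.mulVec w := by
    rw [← Matrix.mulVec_smul, ← h2, Matrix.mulVec_mulVec, a.u₀_u₁, Matrix.smul_mulVec,
      Matrix.one_mulVec]
  have h4 : Y = a.u₀.mulVec w := funext fun i => mul_left_cancel₀ hW (congrFun h3 i)
  refine ⟨π ∘ w, ?_⟩
  rw [h4]
  exact funext fun i => (RingHom.map_mulVec π a.u₀ w i).symm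

/-- The degrees of the generators of the periodic resolution. -/
def MF.periodicGens (a : X.MF) : ℤ → FreeData r
  | Int.ofNat 0 => a.P₀
  | Int.ofNat (_ + 1) => { ι := Empty, deg := Empty.elim }
  -- This is degree `-(k + 1)`. Each inverse shift swaps the two modules, so the terms run through
  -- `P₁`, `P₀{-2}`, `P₁{-2}`, ….
  | Int.negSucc k => (a.unshiftIter k).P₁

/-- The differential of the periodic resolution. -/
def MF.periodicD (a : X.MF) :
    ∀ i : ℤ, X.freeMod (a.periodicGens i) ⟶ X.freeMod (a.periodicGens (i + 1))
  | Int.ofNat _ => 0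
  | Int.negSucc 0 => a.u₁'
  -- The target fits definitionally: `P₀` of an inverse shift is `P₁` of the factorization before
  -- it.
  | Int.negSucc (k + 1) => (a.unshiftIter (k + 1)).u₁'

theorem MF.periodicD_comp (a : X.MF) : ∀ i : ℤ, a.periodicD i ≫ a.periodicD (i + 1) = 0
  | Int.ofNat _ => Limits.zero_comp
  | Int.negSucc 0 => Limits.comp_zero (f := a.u₁')
  | Int.negSucc 1 => a.unshift_u₁'_comp
  | Int.negSucc (k + 2) => (a.unshiftIter (k + 1)).unshift_u₁'_comp

/-- The complex `⋯ → P₁{-2} → P₀{-2} → P₁ → P₀` of free `S'`-modules. -/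
def MF.periodicCx (a : X.MF) : X.FreeCx where
  F := CochainComplex.of (fun i => X.freeMod (a.periodicGens i)) a.periodicD a.periodicD_comp
  gens := a.periodicGens
  basis i := Iso.refl _
  bounded := ⟨0, (CochainComplex.isStrictlyLE_iff _ _).2 fun i hi => by
    obtain ⟨k, rfl⟩ : ∃ k : ℕ, i = Int.ofNat (k + 1) := ⟨(i - 1).toNat, by simp; lia⟩
    rw [Limits.IsZero.iff_id_eq_zero]
    exact freeMod_hom_ext (P := { ι := Empty, deg := Empty.elim }) fun j => j.elim⟩

/-- In degree `0` the neighbouring terms `F.X 1`, `L.X (-1)` and `L.X 1` vanish, so the condition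
there is that `F⁻¹ → F⁰ → L⁰` is exact with surjective second map. In every other degree `L` is
exact, and only exactness of `F` is left. -/
theorem isQis_of_target_concentrated {F L : X.Cx} (φ : F ⟶ L)
    (hL : ∀ i, i ≠ 0 → Limits.IsZero (L.X i)) (hF : Limits.IsZero (F.X 1))
    (hsurj : Function.Surjective (φ.f 0).1)
    (h0 : ∀ x, (φ.f 0).1 x = 0 → ∃ y, (F.d (-1) 0).1 y = x)
    (hex : ∀ i j k : ℤ, i + 1 = j → j + 1 = k → j ≠ 0 →
      ∀ x, (F.d j k).1 x = 0 → ∃ y, (F.d i j).1 y = x) : IsQis φ := by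
  let T := (forgetGrading X).mapHomologicalComplex (ComplexShape.up ℤ)
  refine ⟨fun i => ?_⟩
  by_cases hi : i = 0
  · subst hi
    rw [quasiIsoAt_iff' (T.map φ) (-1) 0 1 (by simp) (by simp),
      ShortComplex.quasiIso_iff_of_zeros']
    · refine ⟨(ShortComplex.moduleCat_exact_iff _).2 h0, ?_⟩
      exact (ModuleCat.epi_iff_surjective _).2 hsurj
    · exact ((forgetGrading X).map_isZero hF).eq_of_tgt _ _
    · exact ((forgetGrading X).map_isZero (hL (-1) (by simp))).eq_of_src _ _
    · exact ((forgetGrading X).map_isZero (hL 1 (by simp))).eq_of_tgt _ _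
  · have h1 : (T.obj L).ExactAt i := by
      rw [HomologicalComplex.exactAt_iff]
      exact ShortComplex.exact_of_isZero_X₂ _ ((forgetGrading X).map_isZero (hL i hi))
    rw [quasiIsoAt_iff_exactAt' _ _ h1,
      HomologicalComplex.exactAt_iff' _ (i - 1) i (i + 1) (by simp) (by simp),
      ShortComplex.moduleCat_exact_iff]
    exact hex _ _ _ (sub_add_cancel i 1) rfl hi

theorem MF.periodicCx_d (a : X.MF) (i : ℤ) : a.periodicCx.F.d i (i + 1) = a.periodicD i :=
  CochainComplex.of_d (X := fun i => X.freeMod (a.periodicGens i)) (d := a.periodicD) i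

theorem MF.periodicCx_exact (hW : X.W ≠ 0) (a : X.MF) (i j k : ℤ) (hij : i + 1 = j)
    (hjk : j + 1 = k) (hj : j ≠ 0) (x : (a.periodicCx.F.X j).carrier)
    (hx : (a.periodicCx.F.d j k).1 x = 0) : ∃ y, (a.periodicCx.F.d i j).1 y = x := by
  subst hij hjk
  rw [periodicCx_d] at hx ⊢
  match i, hj, x, hx with
  | Int.ofNat k, _, x, _ => exact ⟨0, funext fun e : Empty => e.elim⟩
  | Int.negSucc 0, hj, _, _ => exact absurd rfl hj
  | Int.negSucc 1, _, x, hx => exact a.exact_u₁' hW x hx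
  | Int.negSucc (k + 2), _, x, hx => exact (a.unshiftIter (k + 1)).exact_u₁' hW x hx

/-- The projection `P₀ → coker u₁`. -/
def MF.cokerProj (a : X.MF) : X.freeMod a.P₀ ⟶ a.cokerMod :=
  ⟨(LinearMap.range a.u₁'.1).mkQ, fun _ m hm => ⟨m, hm, rfl⟩⟩

theorem MF.u₁'_comp_cokerProj (a : X.MF) : a.u₁' ≫ a.cokerProj = 0 :=
  GrMod.hom_ext (LinearMap.range_mkQ_comp a.u₁'.1)

variable (X) in
/-- A graded module as a complex in degree `0`. -/
abbrev single₀ (N : X.GrMod) : X.Cx :=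
  (HomologicalComplex.single X.GrMod (ComplexShape.up ℤ) 0).obj N

/-- The augmentation of the periodic resolution. -/
def MF.periodicAug (a : X.MF) : a.periodicCx.F ⟶ X.single₀ a.cokerMod :=
  HomologicalComplex.mkHomToSingle (K := a.periodicCx.F) (j := 0) a.cokerProj (by
    intro i hi
    obtain rfl : i = -1 := by
      have : i + 1 = 0 := hi
      lia
    refine Eq.trans ?_ a.u₁'_comp_cokerProj
    exact congrArg (· ≫ a.cokerProj) (a.periodicCx_d (-1)))

theorem MF.isQis_periodicAug (hW : X.W ≠ 0) (a : X.MF) : IsQis a.periodicAug := by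
  have e : a.periodicAug.f 0 = a.cokerProj ≫
      (HomologicalComplex.singleObjXSelf (ComplexShape.up ℤ) 0 a.cokerMod).inv :=
    HomologicalComplex.mkHomToSingle_f _ _
  set ι := HomologicalComplex.singleObjXSelf (ComplexShape.up ℤ) 0 a.cokerMod with hι
  have hinj : ∀ y, ι.inv.1 y = 0 → y = 0 := by
    intro y hy
    have := congrArg ι.hom.1 hy
    rwa [← GrMod.comp_apply, ι.inv_hom_id, map_zero] at this
  refine isQis_of_target_concentrated _
    (fun i hi => HomologicalComplex.isZero_single_obj_X _ _ _ _ hi) ?_ ?_ ?_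
    (a.periodicCx_exact hW)
  · rw [Limits.IsZero.iff_id_eq_zero]
    exact freeMod_hom_ext (P := { ι := Empty, deg := Empty.elim }) fun j => j.elim
  · rw [e]
    intro z
    obtain ⟨x, hx⟩ := Submodule.mkQ_surjective (LinearMap.range a.u₁'.1) (ι.hom.1 z)
    refine ⟨x, (congrArg ι.inv.1 hx).trans ?_⟩
    rw [← GrMod.comp_apply, ι.hom_inv_id, GrMod.id_apply]
  · rw [e]
    intro x hx
    obtain ⟨y, hy⟩ := (Submodule.Quotient.mk_eq_zero _).1 (hinj _ hx)
    refine ⟨y, ?_⟩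
    rw [show a.periodicCx.F.d (-1) 0 = a.u₁' from a.periodicCx_d (-1)]
    exact hy

/-! ### The Euler characteristic of the periodic resolution -/

/-- The pairing of `-2j` with `-(2j+1)` matches the two-periodicity of the resolution. It also
serves to split a sum over exponents by parity. -/
theorem _root_.finsum_int_eq_finsum_nat (G : ℤ → ℤ) (hG : (Function.support G).Finite)
    (hpos : ∀ i, 0 < i → G i = 0) :
    ∑ᶠ i, G i = ∑ᶠ j : ℕ, (G (-(2 * j)) + G (-(2 * j + 1))) := by
  obtain ⟨N, hN⟩ : ∃ N : ℕ, ∀ i, G i ≠ 0 → -(2 * N : ℤ) < i := by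
    obtain ⟨B, hB⟩ := hG.bddBelow
    refine ⟨(-B).toNat + 1, fun i hi => ?_⟩
    have := hB hi
    push_cast
    lia
  have key : ∀ M : ℕ, ∑ k ∈ Finset.range (2 * M), G (-k) =
      ∑ j ∈ Finset.range M, (G (-(2 * j)) + G (-(2 * j + 1))) := by
    intro M
    induction M with
    | zero => simp
    | succ M ih =>
      rw [Finset.sum_range_succ _ M, ← ih, mul_add, mul_one, Finset.sum_range_succ,
        Finset.sum_range_succ]
      push_cast
      ring
  rw [finsum_eq_sum_of_support_subset (s := Finset.range N), ← key,
    finsum_eq_sum_of_support_subset (s := (Finset.range (2 * N)).image fun k : ℕ => -(k : ℤ)),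
    Finset.sum_image]
  · intro x _ y _ h
    simpa using h
  · intro i hi
    have h1 := hN i hi
    have h2 : i ≤ 0 := by
      by_contra h
      exact hi (hpos i (by lia))
    simp only [Finset.coe_image, Set.mem_image, Finset.coe_range, Set.mem_Iio]
    exact ⟨(-i).toNat, by lia, by lia⟩
  · intro j hj
    by_contra h
    simp only [Finset.coe_range, Set.mem_Iio, not_lt] at h
    have h1 : G (-(2 * j)) = 0 := by
      by_contra h1
      have := hN _ h1
      lia
    have h2 : G (-(2 * j + 1)) = 0 := by
      by_contra h1
      have := hN _ h1
      lia
    exact hj ((congrArg₂ (· + ·) h1 h2).trans (add_zero 0))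

/-- The difference of the numbers of generators of `P₀` and `P₁`. -/
def MF.chi (a : X.MF) (d : Deg r) : ℤ := a.P₀.count d - a.P₁.count d

/-- Two inverse shifts restore `P₀` and `P₁` up to `{-2}`, so counting at `m` becomes counting at `m
+ 1`. -/
theorem MF.count_unshiftIter (a : X.MF) (j : ℕ) (v : Fin r → ℤ) (m : ℤ) :
    (a.unshiftIter (2 * j)).P₀.count (v, m) = a.P₀.count (v, m + j) ∧
      (a.unshiftIter (2 * j)).P₁.count (v, m) = a.P₁.count (v, m + j) := by
  induction j generalizing m with
  | zero => simp [unshiftIter]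
  | succ j ih =>
    have e : (v, m) - -degW r = (v, m + 1) := by simp [degW]
    constructor
    · refine (FreeData.count_shift (a.unshiftIter (2 * j)).P₀ _ _).trans ?_
      rw [e, (ih _).1]
      congr 2
      push_cast
      ring
    · refine (FreeData.count_shift (a.unshiftIter (2 * j)).P₁ _ _).trans ?_
      rw [e, (ih _).2]
      congr 2
      push_cast
      ring

theorem MF.count_periodicGens_even (a : X.MF) (j : ℕ) (v : Fin r → ℤ) (m : ℤ) :
    (a.periodicGens (-(2 * j))).count (v, m) = a.P₀.count (v, m + j) := by
  cases j with
  | zero => simp [periodicGens]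
  | succ j =>
    have e : (-(2 * (j + 1 : ℕ)) : ℤ) = Int.negSucc (2 * j + 1) := by
      rw [Int.negSucc_eq]
      push_cast
      ring
    rw [e]
    refine (FreeData.count_shift _ _ _).trans ?_
    rw [show (v, m) - -degW r = (v, m + 1) by simp [degW], (a.count_unshiftIter j v _).1]
    congr 2
    push_cast
    ring

theorem MF.count_periodicGens_odd (a : X.MF) (j : ℕ) (v : Fin r → ℤ) (m : ℤ) :
    (a.periodicGens (-(2 * j + 1))).count (v, m) = a.P₁.count (v, m + j) := by
  have e : (-(2 * j + 1) : ℤ) = Int.negSucc (2 * j) := by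
    rw [Int.negSucc_eq]
    push_cast
    ring
  rw [e]
  exact (a.count_unshiftIter j v m).2

theorem MF.count_periodicGens_pos (a : X.MF) {i : ℤ} (hi : 0 < i) (d : Deg r) :
    (a.periodicGens i).count d = 0 := by
  obtain ⟨k, rfl⟩ : ∃ k : ℕ, i = Int.ofNat (k + 1) := ⟨(i - 1).toNat, by simp; lia⟩
  exact Fintype.card_eq_zero_iff.2 ⟨fun j => j.1.elim⟩

/-- The degree `(v, m)` occurs at position `-2j` or `-(2j+1)` only if `m + j` is the `R`-component
of some generator of `P₀` or `P₁`. These are bounded by `B`, which forces `j ≤ B - m`. -/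
theorem MF.periodicCx_summable (a : X.MF) : a.periodicCx.Summable := by
  rintro ⟨v, m⟩
  have hfin := (a.P₀.finite_count_ne_zero.union a.P₁.finite_count_ne_zero).image Prod.snd
  obtain ⟨B, hB⟩ := hfin.bddAbove
  have hB' : ∀ p, B < p → a.P₀.count (v, p) = 0 ∧ a.P₁.count (v, p) = 0 := by
    intro p hp
    by_contra h
    refine absurd (hB ⟨(v, p), ?_, rfl⟩) (not_le.2 hp)
    by_contra h'
    simp only [Set.mem_union, Set.mem_ofPred_eq, not_or, not_not] at h'
    exact h h'
  refine (Set.finite_Icc (-(2 * (B - m) + 1)) 0).subset fun i hi => ?_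
  have hi0 : i ≤ 0 := by
    by_contra h
    exact hi (a.count_periodicGens_pos (by lia) _)
  refine ⟨?_, hi0⟩
  by_contra h
  refine hi ?_
  obtain ⟨j, hj | hj⟩ : ∃ j : ℕ, i = -(2 * j : ℤ) ∨ i = -(2 * j + 1 : ℤ) :=
    ⟨(-i / 2).toNat, by lia⟩
  · subst hj
    exact (a.count_periodicGens_even j v m).trans (hB' _ (by lia)).1
  · subst hj
    exact (a.count_periodicGens_odd j v m).trans (hB' _ (by lia)).2

/-- The right side is the coefficient of `s^v σ^{-2m}` in `(k(P₀) - k(P₁))(1 + σ² + ⋯)`: the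
exponent `-2m - 2j` is that of `(v, m + j)`. -/
theorem MF.euler_periodicCx (a : X.MF) (v : Fin r → ℤ) (m : ℤ) :
    a.periodicCx.euler (v, m) = ∑ᶠ j : ℕ, a.chi (v, m + j) := by
  rw [FreeCx.euler, finsum_int_eq_finsum_nat _
    (FreeCx.finite_support a.periodicCx_summable (v, m)) (fun i hi => by
      simp [periodicCx, a.count_periodicGens_pos hi])]
  refine finsum_congr fun j => ?_
  have h1 : (-(2 * (j : ℤ))).negOnePow = 1 := Int.negOnePow_even _ ⟨-j, by ring⟩
  have h2 : (-(2 * (j : ℤ) + 1)).negOnePow = -1 := Int.negOnePow_odd _ ⟨-j - 1, by ring⟩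
  simp only [periodicCx, a.count_periodicGens_even, a.count_periodicGens_odd, h1, h2, chi]
  simp
  ring

theorem MF.hasRes_coker (hW : X.W ≠ 0) (a : X.MF) :
    HasRes (X.toK.obj (X.single₀ a.cokerMod)) a.periodicCx.euler :=
  ⟨a.periodicCx, a.periodicCx_summable, rfl, X.toK.map a.periodicAug,
    (isQis_iff _).1 (a.isQis_periodicAug hW)⟩

end SigmaModel

/-! ### Laurent polynomials and formal series of periodic form -/

theorem LaurentSσ.finite_support_coeff {r : ℕ} (f : LaurentSσ r) (v : Fin r → ℤ) :
    (Function.support fun k : ℤ => f.coeff (v, k)).Finite :=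
  (f.coeff.hasFiniteSupport).preimage (Prod.mk_right_injective v).injOn

/-- The value at `σ = 1` is determined by the series. -/
theorem HasPeriodicForm.exists_sum_eq {r : ℕ} {K : FormalSeries r} {f g : LaurentSσ r}
    (h : HasPeriodicForm K f g) (v : Fin r → ℤ) :
    ∃ B : ℤ, ∀ k, B ≤ k → ∑ᶠ i : ℤ, f.coeff (v, i) = K v k + K v (k + 1) := by
  obtain ⟨B, hB⟩ := ((LaurentSσ.finite_support_coeff f v).union
    (LaurentSσ.finite_support_coeff g v)).bddAbove
  have hfB : ∀ k, B < k → f.coeff (v, k) = 0 := fun k hk => by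
    by_contra h0
    exact absurd (hB (Or.inl h0)) (not_le.2 hk)
  have hgB : ∀ k, B < k → g.coeff (v, k) = 0 := fun k hk => by
    by_contra h0
    exact absurd (hB (Or.inr h0)) (not_le.2 hk)
  refine ⟨B + 1, fun k hk => ?_⟩
  have h1 := finsum_comp_equiv (Equiv.addLeft (k + 1)) (f := fun i : ℤ => f.coeff (v, i))
  have hfin : ∀ c : ℤ, (Function.support fun i : ℕ => f.coeff (v, c - 2 * (i : ℤ))).Finite :=
    fun c => (LaurentSσ.finite_support_coeff f v).preimage (f := fun i : ℕ => c - 2 * (i : ℤ))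
      (fun a _ b _ hab => by
        simp only at hab
        lia)
  -- Beyond both supports `g` drops out. The two series collect the coefficients of `f` at exponents
  -- `≤ k + 1`, one for each parity, and these are all its nonzero coefficients.
  rw [h v k, h v (k + 1), hgB k (by lia), hgB (k + 1) (by lia), add_zero, add_zero,
    ← finsum_add_distrib (hfin _) (hfin _), ← h1, finsum_int_eq_finsum_nat]
  · refine finsum_congr fun j => ?_
    simp only [Equiv.coe_addLeft]
    rw [show k + 1 + -(2 * (j : ℤ)) = k + 1 - 2 * j by ring,
      show k + 1 + -(2 * (j : ℤ) + 1) = k - 2 * j by ring, add_comm]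
  · exact (LaurentSσ.finite_support_coeff f v).preimage (Equiv.addLeft (k + 1)).injective.injOn
  · intro i hi
    exact hfB _ (by simp only [Equiv.coe_addLeft]; lia)

theorem HasPeriodicForm.sum_eq {r : ℕ} {K : FormalSeries r} {f g f' g' : LaurentSσ r}
    (h : HasPeriodicForm K f g) (h' : HasPeriodicForm K f' g') (v : Fin r → ℤ) :
    ∑ᶠ i : ℤ, f.coeff (v, i) = ∑ᶠ i : ℤ, f'.coeff (v, i) := by
  obtain ⟨B, hB⟩ := h.exists_sum_eq v
  obtain ⟨B', hB'⟩ := h'.exists_sum_eq v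
  rw [hB (max B B') (le_max_left _ _), hB' (max B B') (le_max_right _ _)]

/-! ### The contour integral -/

theorem evalσ_eq_sum {r : ℕ} (f : LaurentSσ r) (v : Fin r → ℤ) :
    ∃ s : Finset ℤ, ∀ z : ℂ, evalσ f v z = ∑ k ∈ s, (f.coeff (v, k) : ℂ) * z ^ k := by
  refine ⟨(LaurentSσ.finite_support_coeff f v).toFinset, fun z => ?_⟩
  refine finsum_eq_sum_of_support_subset _ fun k hk => ?_
  rw [Set.Finite.coe_toFinset]
  exact fun h => hk (by simp [h])

theorem evalσ_one {r : ℕ} (f : LaurentSσ r) (v : Fin r → ℤ) :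
    evalσ f v 1 = ((∑ᶠ k : ℤ, f.coeff (v, k) : ℤ) : ℂ) := by
  refine Eq.trans ?_
    ((Int.castAddHom ℂ).map_finsum (LaurentSσ.finite_support_coeff f v)).symm
  simp [evalσ]

theorem differentiableOn_evalσ {r : ℕ} (f : LaurentSσ r) (v : Fin r → ℤ) {s : Set ℂ}
    (hs : ∀ z ∈ s, z ≠ 0) : DifferentiableOn ℂ (evalσ f v) s := by
  obtain ⟨t, ht⟩ := evalσ_eq_sum f v
  rw [funext ht]
  refine DifferentiableOn.fun_sum fun k _ => DifferentiableOn.const_mul ?_ _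
  exact fun z hz => (differentiableAt_zpow.2 (Or.inl (hs z hz))).differentiableWithinAt

/-- Since `1/(1 - z²) = -1/((z - 1)(1 + z))`, Cauchy's formula at `z = 1` gives `2πi · (-f(1)/2)`,
while `g` is holomorphic on the disc and contributes nothing. The clockwise orientation cancels the
sign. -/
theorem contourIntegral_eq {r : ℕ} (f g : LaurentSσ r) (v : Fin r → ℤ) {ε : ℝ} (h0 : 0 < ε)
    (h1 : ε < 1) : contourIntegral f g v ε = ((∑ᶠ k : ℤ, f.coeff (v, k) : ℤ) : ℂ) := by
  -- As `ε < 1`, the disc lies in the right half plane. This avoids both the other pole `-1` and the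
  -- point `0`, where negative powers of `z` are singular.
  have hre : ∀ z ∈ Metric.closedBall (1 : ℂ) ε, 0 < z.re := by
    intro z hz
    have := (Complex.abs_re_le_norm (z - 1)).trans (mem_closedBall_iff_norm.1 hz)
    rw [Complex.sub_re, Complex.one_re, abs_le] at this
    linarith
  have hne : ∀ z ∈ Metric.closedBall (1 : ℂ) ε, z ≠ 0 := by
    rintro z hz rfl
    exact lt_irrefl 0 (hre 0 hz)
  have hne' : ∀ z ∈ Metric.closedBall (1 : ℂ) ε, 1 + z ≠ 0 := by
    intro z hz h
    have h2 := congrArg Complex.re h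
    have h3 := hre z hz
    simp only [Complex.add_re, Complex.one_re, Complex.zero_re] at h2
    linarith
  have hf : DifferentiableOn ℂ (fun z => -(evalσ f v z / (1 + z))) (Metric.closedBall 1 ε) :=
    ((differentiableOn_evalσ f v hne).div
      ((differentiableOn_const _).add differentiableOn_id) hne').neg
  have hg := differentiableOn_evalσ g v hne
  have hsub : Metric.sphere (1 : ℂ) ε ⊆ Metric.closedBall 1 ε := Metric.sphere_subset_closedBall
  have hz1 : ∀ z ∈ Metric.sphere (1 : ℂ) ε, z - 1 ≠ 0 := by
    intro z hz h
    rw [mem_sphere_iff_norm, h, norm_zero] at hz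
    exact h0.ne hz
  have hcong : (∮ z in C(1, ε), (evalσ f v z / (1 - z ^ 2) + evalσ g v z)) =
      ∮ z in C(1, ε), ((z - 1)⁻¹ • (-(evalσ f v z / (1 + z))) + evalσ g v z) := by
    refine circleIntegral.integral_congr h0.le fun z hz => ?_
    have e1 := hz1 z hz
    have e2 := hne' z (hsub hz)
    have e3 : 1 - z ^ 2 = -((z - 1) * (1 + z)) := by ring
    simp only [e3, smul_eq_mul]
    field_simp
  have hi1 : CircleIntegrable (fun z => (z - 1)⁻¹ • (-(evalσ f v z / (1 + z)))) 1 ε :=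
    ContinuousOn.circleIntegrable h0.le
      (((continuousOn_id.sub continuousOn_const).inv₀ hz1).smul (hf.continuousOn.mono hsub))
  have hi2 : CircleIntegrable (evalσ g v) 1 ε :=
    ContinuousOn.circleIntegrable h0.le (hg.continuousOn.mono hsub)
  rw [contourIntegral, hcong, circleIntegral.integral_add hi1 hi2,
    hf.circleIntegral_sub_inv_smul (Metric.mem_ball_self h0),
    (hg.mono Metric.closure_ball_subset_closedBall).diffContOnCl.circleIntegral_eq_zero h0.le,
    ← evalσ_one]
  have hpi : (Real.pi : ℂ) ≠ 0 := by exact_mod_cast Real.pi_ne_zero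
  have hI := Complex.I_ne_zero
  rw [smul_eq_mul]
  field_simp
  ring

/-! ### Laurent polynomials of graded free modules -/

namespace FreeData

variable {r : ℕ}

/-- The Laurent polynomial `∑ s^v σ^{-2m}` over the summands `S(v){2m}`. -/
def laurent (P : FreeData r) : LaurentSσ r :=
  ∑ j, AddMonoidAlgebra.single ((P.deg j).1, -(2 * (P.deg j).2)) 1

/-- The Laurent polynomial `∑ s^v` over the summands `S(v){2m}`. -/
def toricLaurent (P : FreeData r) : LaurentS r :=
  ∑ j, AddMonoidAlgebra.single (P.deg j).1 1

theorem laurent_coeff (P : FreeData r) (v : Fin r → ℤ) (k : ℤ) :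
    P.laurent.coeff (v, k) = ∑ j, if (P.deg j).1 = v ∧ -(2 * (P.deg j).2) = k then 1 else 0 := by
  rw [laurent, AddMonoidAlgebra.coeff_sum, Finsupp.finsetSum_apply]
  refine Finset.sum_congr rfl fun j _ => ?_
  rw [AddMonoidAlgebra.coeff_single, Finsupp.single_apply]
  exact if_congr Prod.mk_inj rfl rfl

theorem toricLaurent_coeff (P : FreeData r) (v : Fin r → ℤ) :
    P.toricLaurent.coeff v = ∑ j, if (P.deg j).1 = v then 1 else 0 := by
  rw [toricLaurent, AddMonoidAlgebra.coeff_sum, Finsupp.finsetSum_apply]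
  refine Finset.sum_congr rfl fun j _ => ?_
  rw [AddMonoidAlgebra.coeff_single, Finsupp.single_apply]

theorem laurent_coeff_even (P : FreeData r) (v : Fin r → ℤ) (m : ℤ) :
    P.laurent.coeff (v, -(2 * m)) = P.count (v, m) := by
  rw [laurent_coeff, count_eq_sum]
  push_cast
  refine Finset.sum_congr rfl fun j _ => if_congr ?_ rfl rfl
  rw [Prod.ext_iff]
  exact and_congr_right fun _ => by lia

theorem laurent_coeff_odd (P : FreeData r) (v : Fin r → ℤ) {k : ℤ} (hk : Odd k) :
    P.laurent.coeff (v, k) = 0 := by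
  rw [laurent_coeff]
  refine Finset.sum_eq_zero fun j _ => if_neg fun h => ?_
  obtain ⟨i, hi⟩ := hk
  lia

theorem finsum_laurent_coeff (P : FreeData r) (v : Fin r → ℤ) :
    ∑ᶠ k : ℤ, P.laurent.coeff (v, k) = P.toricLaurent.coeff v := by
  rw [toricLaurent_coeff, finsum_congr (P.laurent_coeff v), finsum_sum_comm]
  · refine Finset.sum_congr rfl fun j _ => ?_
    rw [finsum_eq_single _ (-(2 * (P.deg j).2)) fun k hk => if_neg fun h => hk h.2.symm]
    simp
  · intro j _
    refine (Set.finite_singleton (-(2 * (P.deg j).2))).subset fun k hk => ?_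
    by_contra h
    exact hk (if_neg fun h' => h h'.2.symm)

theorem toricLaurent_shift (P : FreeData r) {e : Deg r} (he : e.1 = 0) :
    (P.shift e).toricLaurent = P.toricLaurent :=
  Finset.sum_congr rfl fun j _ => by simp [he]

theorem toricLaurent_sum (P Q : FreeData r) :
    (P.sum Q).toricLaurent = P.toricLaurent + Q.toricLaurent :=
  Fintype.sum_sum_type _

end FreeData

namespace SigmaModel

variable {r n l : ℕ} {X : SigmaModel r n l}

/-- The Laurent polynomial `k(P₀) - k(P₁)`. -/
def MF.laurent (a : X.MF) : LaurentSσ r := a.P₀.laurent - a.P₁.laurent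

/-- The value of `k(P₀) - k(P₁)` at `σ = 1`. -/
def MF.toricLaurent (a : X.MF) : LaurentS r := a.P₀.toricLaurent - a.P₁.toricLaurent

theorem MF.finsum_laurent_coeff (a : X.MF) (v : Fin r → ℤ) :
    ∑ᶠ k : ℤ, a.laurent.coeff (v, k) = a.toricLaurent.coeff v :=
  (finsum_sub_distrib (LaurentSσ.finite_support_coeff _ v)
    (LaurentSσ.finite_support_coeff _ v)).trans
    (congrArg₂ (· - ·) (a.P₀.finsum_laurent_coeff v) (a.P₁.finsum_laurent_coeff v))

theorem MF.laurent_coeff_even (a : X.MF) (v : Fin r → ℤ) (m : ℤ) :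
    a.laurent.coeff (v, -(2 * m)) = a.chi (v, m) :=
  congrArg₂ (· - ·) (a.P₀.laurent_coeff_even v m) (a.P₁.laurent_coeff_even v m)

theorem MF.laurent_coeff_odd (a : X.MF) (v : Fin r → ℤ) {k : ℤ} (hk : Odd k) :
    a.laurent.coeff (v, k) = 0 :=
  (congrArg₂ (· - ·) (a.P₀.laurent_coeff_odd v hk) (a.P₁.laurent_coeff_odd v hk)).trans
    (sub_zero 0)

/-- The periodic resolution accounts for `f = k(P₀) - k(P₁)`; the finitely supported difference `e -
a.periodicCx.euler`, transported to exponents `(v, -2m)`, is the correction `g`. -/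
theorem MF.hasPeriodicForm (a : X.MF) {e : Deg r → ℤ}
    (he : (Function.support (e - a.periodicCx.euler)).Finite) :
    ∃ g, HasPeriodicForm (formalSeries e) a.laurent g := by
  let δ : Deg r →₀ ℤ := Finsupp.ofSupportFinite _ he
  let ι : Deg r → (Fin r → ℤ) × ℤ := fun d => (d.1, -(2 * d.2))
  have hι : Function.Injective ι := fun d d' h => by
    simp only [ι, Prod.mk.injEq, neg_inj] at h
    exact Prod.ext h.1 (by lia)
  refine ⟨AddMonoidAlgebra.ofCoeff (Finsupp.mapDomain ι δ), fun v k => ?_⟩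
  change _ = _ + Finsupp.mapDomain ι δ (v, k)
  rcases Int.even_or_odd k with ⟨j, rfl⟩ | hk
  · have hj : j + j = -(2 * (-j)) := by ring
    rw [hj, formalSeries_even, show (v, -(2 * -j)) = ι (v, -j) from rfl,
      Finsupp.mapDomain_apply hι]
    have h1 : δ (v, -j) = e (v, -j) - a.periodicCx.euler (v, -j) := rfl
    rw [h1, a.euler_periodicCx, finsum_congr (f := fun i : ℕ => a.laurent.coeff
      (v, -(2 * -j) - 2 * (i : ℤ))) (g := fun i : ℕ => a.chi (v, -j + i))]
    · ring
    · intro i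
      rw [← a.laurent_coeff_even]
      congr 2
      ring
  · rw [formalSeries_odd _ _ hk, Finsupp.mapDomain_of_notMem_range,
      finsum_eq_zero_of_forall_eq_zero, add_zero]
    · intro i
      exact a.laurent_coeff_odd v (hk.sub_even ⟨i, by ring⟩)
    · rintro ⟨d, hd⟩
      obtain ⟨i, hi⟩ := hk
      have : -(2 * d.2) = k := congrArg Prod.snd hd
      lia

/-! ### Invariance under isomorphisms of `DGr S(W)` -/

/-- The matrix at the origin. -/
abbrev originMap {ι κ : Type*} (A : Matrix ι κ X.S) : Matrix ι κ ℂ :=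
  A.map MvPolynomial.constantCoeff

theorem originMap_mul {ι κ μ : Type*} [Fintype κ] (A : Matrix ι κ X.S) (B : Matrix κ μ X.S) :
    originMap (A * B) = originMap A * originMap B :=
  Matrix.map_mul

theorem originMap_add {ι κ : Type*} (A B : Matrix ι κ X.S) :
    originMap (A + B) = originMap A + originMap B :=
  Matrix.map_add _ (map_add _) A B

/-- The trace at the origin of the part of toric degree `v`. -/
def toricTrace (P : FreeData r) (v : Fin r → ℤ) (A : Matrix P.ι P.ι X.S) : ℂ :=
  gradedTrace (fun j => (P.deg j).1) v (originMap A)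

theorem toricTrace_add (P : FreeData r) (v : Fin r → ℤ) (A B : Matrix P.ι P.ι X.S) :
    toricTrace P v (A + B) = toricTrace P v A + toricTrace P v B := by
  rw [toricTrace, originMap_add, gradedTrace_add]
  rfl

theorem toricTrace_one (P : FreeData r) (v : Fin r → ℤ) :
    toricTrace P v (1 : Matrix P.ι P.ι X.S) = (P.toricLaurent.coeff v : ℤ) := by
  have h : originMap (1 : Matrix P.ι P.ι X.S) = 1 :=
    Matrix.map_one _ (map_zero MvPolynomial.constantCoeff) (map_one MvPolynomial.constantCoeff)
  rw [toricTrace, h, gradedTrace_one,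
    FreeData.toricLaurent_coeff, Fintype.card_subtype, Finset.card_filter]
  push_cast
  rfl

/-- Only the toric degree has to be preserved. A nonzero `R`-degree is allowed because `u₀` raises
it, so this cyclicity is available after setting `σ = 1`. -/
theorem toricTrace_mul_comm {P Q : FreeData r} {e : Deg r} (he : e.1 = 0) (v : Fin r → ℤ)
    {A : Matrix Q.ι P.ι X.S} (hA : X.IsHomMat P Q e A) (B : Matrix P.ι Q.ι X.S) :
    toricTrace P v (B * A) = toricTrace Q v (A * B) := by
  rw [toricTrace, toricTrace, originMap_mul, originMap_mul]
  refine gradedTrace_mul_comm _ _ _ _ _ fun i j hij => ?_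
  refine constantCoeff_eq_zero (hA i j) fun h => hij ?_
  have h1 := congrArg Prod.fst h
  rw [Prod.fst_add, he, add_zero] at h1
  exact sub_eq_zero.1 h1

/-- The supertrace at the origin of the part of toric degree `v` of an endomorphism. -/
def MF.superTrace {a : X.MF} (v : Fin r → ℤ) (φ : a ⟶ a) : ℂ :=
  toricTrace a.P₀ v (MF.Hom.f₀ φ) - toricTrace a.P₁ v (MF.Hom.f₁ φ)

theorem MF.superTrace_id (a : X.MF) (v : Fin r → ℤ) :
    MF.superTrace v (𝟙 a) = (a.toricLaurent.coeff v : ℤ) := by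
  refine (congrArg₂ (· - ·) (toricTrace_one a.P₀ v) (toricTrace_one a.P₁ v)).trans ?_
  exact (Int.cast_sub _ _).symm

theorem MF.superTrace_comp_comm {a b : X.MF} (v : Fin r → ℤ) (φ : a ⟶ b) (ψ : b ⟶ a) :
    MF.superTrace v (φ ≫ ψ) = MF.superTrace v (ψ ≫ φ) :=
  congrArg₂ (· - ·)
    (toricTrace_mul_comm (e := 0) rfl v (MF.Hom.deg_f₀ φ) (MF.Hom.f₀ ψ))
    (toricTrace_mul_comm (e := 0) rfl v (MF.Hom.deg_f₁ φ) (MF.Hom.f₁ ψ))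

/-- The supertrace is a homotopy invariant. -/
theorem MF.superTrace_eq_of_homotopic {a b : X.MF} (v : Fin r → ℤ) {φ ψ : a ⟶ b}
    (h : X.homotopic φ ψ) (χ : b ⟶ a) :
    MF.superTrace v (χ ≫ φ) = MF.superTrace v (χ ≫ ψ) := by
  obtain ⟨h₀, h₁, -, -, e₁, e₀⟩ := h
  have c₁ := MF.Hom.comm₁ χ
  have c₀ := MF.Hom.comm₀ χ
  -- Moving `u₁` around the trace and past `χ` turns a homotopy term on `P₀` into one on `P₁`. With
  -- `t₁`, all homotopy terms cancel in the supertrace.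
  have t₀ : toricTrace b.P₀ v (b.u₁ * h₀ * MF.Hom.f₀ χ) =
      toricTrace b.P₁ v (h₀ * a.u₁ * MF.Hom.f₁ χ) := by
    rw [Matrix.mul_assoc, ← toricTrace_mul_comm (e := 0) rfl v b.deg_u₁, Matrix.mul_assoc, c₁,
      Matrix.mul_assoc]
  have t₁ : toricTrace b.P₀ v (h₁ * a.u₀ * MF.Hom.f₀ χ) =
      toricTrace b.P₁ v (b.u₀ * h₁ * MF.Hom.f₁ χ) := by
    rw [Matrix.mul_assoc, ← c₀, ← Matrix.mul_assoc,
      toricTrace_mul_comm (e := degW r) rfl v b.deg_u₀, Matrix.mul_assoc]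
  change toricTrace b.P₀ v (MF.Hom.f₀ φ * MF.Hom.f₀ χ) -
      toricTrace b.P₁ v (MF.Hom.f₁ φ * MF.Hom.f₁ χ) =
    toricTrace b.P₀ v (MF.Hom.f₀ ψ * MF.Hom.f₀ χ) - toricTrace b.P₁ v (MF.Hom.f₁ ψ * MF.Hom.f₁ χ)
  rw [e₀, e₁]
  simp only [Matrix.add_mul, toricTrace_add, t₀, t₁]
  ring

/-- Equality in the quotient is generated by homotopies pre- and postcomposed with arbitrary maps.
Cyclicity moves those maps to the front, where they are absorbed into the free factor `χ`. -/
theorem MF.superTrace_eq_of_map_eq {a b : X.MF} (v : Fin r → ℤ) {φ ψ : a ⟶ b}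
    (h : X.toDGr.map φ = X.toDGr.map ψ) (χ : b ⟶ a) :
    MF.superTrace v (χ ≫ φ) = MF.superTrace v (χ ≫ ψ) := by
  have h' := (CategoryTheory.Quotient.functor_homRel_eq_compClosure_eqvGen X.homotopic φ ψ).1 h
  clear h
  induction h' with
  | rel φ ψ h =>
    obtain ⟨_, _, f, m₁, m₂, g, hm⟩ := h
    have key : ∀ m, MF.superTrace v (χ ≫ f ≫ m ≫ g) = MF.superTrace v ((g ≫ χ ≫ f) ≫ m) := by
      intro m
      have := MF.superTrace_comp_comm v (χ ≫ f ≫ m) g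
      simpa using this
    rw [key, key]
    exact MF.superTrace_eq_of_homotopic v hm _
  | refl => rfl
  | symm φ ψ h ih => exact ih.symm
  | trans φ ψ ω h₁ h₂ ih₁ ih₂ => exact ih₁.trans ih₂

/-- For representatives `φ`, `ψ` of mutually inverse maps, `str(φ ≫ ψ) = str(ψ ≫ φ)`, and by
homotopy invariance the two sides are the supertraces of the two identities. -/
theorem MF.toricLaurent_eq_of_iso {A B : X.DGr} (i : A ≅ B) :
    MF.toricLaurent A.as = MF.toricLaurent B.as := by
  obtain ⟨φ, hφ⟩ := X.toDGr.map_surjective (X := A.as) (Y := B.as) i.hom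
  obtain ⟨ψ, hψ⟩ := X.toDGr.map_surjective (X := B.as) (Y := A.as) i.inv
  have h1 : X.toDGr.map (φ ≫ ψ) = X.toDGr.map (𝟙 A.as) := by
    rw [Functor.map_comp, hφ, hψ, CategoryTheory.Functor.map_id]
    exact i.hom_inv_id
  have h2 : X.toDGr.map (ψ ≫ φ) = X.toDGr.map (𝟙 B.as) := by
    rw [Functor.map_comp, hφ, hψ, CategoryTheory.Functor.map_id]
    exact i.inv_hom_id
  refine AddMonoidAlgebra.ext (Finsupp.ext fun v => ?_)
  have h3 := MF.superTrace_eq_of_map_eq v h1 (𝟙 _)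
  have h4 := MF.superTrace_eq_of_map_eq v h2 (𝟙 _)
  rw [Category.id_comp, Category.id_comp, MF.superTrace_id] at h3 h4
  rw [MF.superTrace_comp_comm, h4] at h3
  exact_mod_cast h3.symm

theorem MF.toricLaurent_cone {a b : X.MF} (φ : a ⟶ b) :
    (MF.cone φ).toricLaurent = b.toricLaurent - a.toricLaurent := by
  have h : (MF.cone φ).toricLaurent = (b.P₀.sum (a.P₁.shift (degW r))).toricLaurent -
    (b.P₁.sum a.P₀).toricLaurent := rfl
  rw [h, FreeData.toricLaurent_sum, FreeData.toricLaurent_sum,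
    FreeData.toricLaurent_shift _ (e := degW r) rfl, toricLaurent, toricLaurent]
  abel

variable (X) in
/-- The homomorphism sending the class of `P` to the value of `k(P₀) - k(P₁)` at `σ = 1`. -/
def kappa : X.K₀ →+ LaurentS r :=
  QuotientAddGroup.lift _ (FreeAbelianGroup.lift fun A : X.DGr => MF.toricLaurent A.as) (by
    rw [AddSubgroup.closure_le]
    rintro _ ⟨A, B, C, f, g, h, ⟨a, b, φ, α, β, γ, -⟩, rfl⟩
    change FreeAbelianGroup.lift _ _ = 0
    rw [map_add, map_sub, FreeAbelianGroup.lift_apply_of, FreeAbelianGroup.lift_apply_of,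
      FreeAbelianGroup.lift_apply_of, MF.toricLaurent_eq_of_iso α, MF.toricLaurent_eq_of_iso β,
      MF.toricLaurent_eq_of_iso γ]
    have := MF.toricLaurent_cone φ
    change a.toricLaurent - b.toricLaurent + (MF.cone φ).toricLaurent = 0
    rw [this]
    abel)

theorem kappa_cls (a : X.MF) : X.kappa (K₀.cls (X.toDGr.obj a)) = a.toricLaurent :=
  FreeAbelianGroup.lift_apply_of _ _

theorem K₀.hom_ext {M : Type*} [AddCommGroup M] {κ κ' : X.K₀ →+ M}
    (h : ∀ a : X.MF, κ (K₀.cls (X.toDGr.obj a)) = κ' (K₀.cls (X.toDGr.obj a))) : κ = κ' :=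
  QuotientAddGroup.addMonoidHom_ext _ (FreeAbelianGroup.lift_ext _ _ fun A => h A.as)

/-! ### The cokernel represents the matrix factorization -/

open scoped ZeroObject in
-- The cone of an identity is acyclic, so the zero complex is a finite free resolution of it.
theorem perfect_cone_id (K : X.Cx) : Perfect (CochainComplex.mappingCone (𝟙 K)) := by
  have h1 : Limits.IsZero (X.toD.obj (X.toK.obj (CochainComplex.mappingCone (𝟙 K)))) := by
    refine (Pretriangulated.Triangle.isZero₃_iff_isIso₁ _ (X.toD.map_distinguished _
      (HomotopyCategory.mappingCone_triangleh_distinguished (𝟙 K)))).2 ?_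
    exact inferInstanceAs (IsIso (X.toD.map (X.toK.map (𝟙 K))))
  have h0 : Limits.IsZero (0 : X.Cx) := Limits.isZero_zero _
  have hX : ∀ i, Limits.IsZero ((0 : X.Cx).X i) := fun i =>
    (HomologicalComplex.eval X.GrMod (ComplexShape.up ℤ) i).map_isZero h0
  have hE : Limits.IsZero (X.freeMod { ι := Empty, deg := Empty.elim }) := by
    rw [Limits.IsZero.iff_id_eq_zero]
    exact freeMod_hom_ext fun j => j.elim
  refine ⟨0, 0, ⟨0, 0, (CochainComplex.isStrictlyGE_iff _ _).2 fun i _ => hX i,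
    (CochainComplex.isStrictlyLE_iff _ _).2 fun i _ => hX i⟩,
    fun i => ⟨_, ⟨(hX i).iso hE⟩⟩, ?_⟩
  rw [isQis_iff]
  have h2 := (X.toK ⋙ X.toD).map_isZero h0
  exact ⟨0, Limits.IsZero.eq_of_src h2 _ _, Limits.IsZero.eq_of_src h1 _ _⟩

/-- The identity roof suffices. This ensures that the defining property of `κ` constrains its value
on every factorization. -/
theorem represents_coker (a : X.MF) : Represents (X.single₀ a.cokerMod) a := by
  have hb : Bounded (X.single₀ a.cokerMod) := by
    refine ⟨0, 0, (CochainComplex.isStrictlyGE_iff _ _).2 fun i hi => ?_,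
      (CochainComplex.isStrictlyLE_iff _ _).2 fun i hi => ?_⟩
    · exact HomologicalComplex.isZero_single_obj_X _ _ _ _ hi.ne
    · exact HomologicalComplex.isZero_single_obj_X _ _ _ _ hi.ne'
  exact ⟨hb, _, 𝟙 _, 𝟙 _, hb, perfect_cone_id _, perfect_cone_id _⟩

theorem Represents.exists_hasRes (hW : X.W ≠ 0) {a : X.MF} {M : X.Cx} (h : Represents M a) :
    ∃ e : Deg r → ℤ, HasRes (X.toK.obj M) e ∧
      ∃ g, HasPeriodicForm (formalSeries e) a.laurent g := by
  obtain ⟨e, he, hM⟩ := HasRes.of_isoModPerf h.2 (a.hasRes_coker hW)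
  exact ⟨e, hM, a.hasPeriodicForm he⟩

end SigmaModel

end

/-! ### The main theorem -/

theorem mainTheorem1 {r n l : ℕ} (X : SigmaModel r n l) (hW : X.W ≠ 0) :
    ∃! κ : X.K₀ →+ LaurentS r,
      ∀ (a : X.MF) (M : CochainComplex X.GrMod ℤ), SigmaModel.Represents M a →
        ∃ K : FormalSeries r,
          (∃ R : SigmaModel.FreeResolution M, R.Summable) ∧
          (∀ R : SigmaModel.FreeResolution M, R.Summable → R.series = K) ∧
          (∃ f g : LaurentSσ r, HasPeriodicForm K f g) ∧
          ∀ f g : LaurentSσ r, HasPeriodicForm K f g →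
            ∀ v : Fin r → ℤ,
              (∀ ε : ℝ, 0 < ε → ε < 1 →
                (((κ (SigmaModel.K₀.cls (X.toDGr.obj a))).coeff v : ℤ) : ℂ)
                  = contourIntegral f g v ε) ∧
              (κ (SigmaModel.K₀.cls (X.toDGr.obj a))).coeff v
                = ∑ᶠ k : ℤ, f.coeff (v, k) := by
  refine ⟨X.kappa, fun a M hM => ?_, fun κ hκ => SigmaModel.K₀.hom_ext fun a => ?_⟩
  · obtain ⟨e, he, g₀, hg₀⟩ := hM.exists_hasRes hW
    obtain ⟨R, hR, -⟩ := he.exists_freeResolution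
    refine ⟨SigmaModel.formalSeries e, ⟨R, hR⟩, he.series_eq, ⟨_, _, hg₀⟩, fun f g hfg v => ?_⟩
    have h : (X.kappa (SigmaModel.K₀.cls (X.toDGr.obj a))).coeff v = ∑ᶠ k : ℤ, f.coeff (v, k) := by
      rw [SigmaModel.kappa_cls, ← a.finsum_laurent_coeff, hg₀.sum_eq hfg]
    exact ⟨fun ε h0 h1 => by rw [h, contourIntegral_eq f g v h0 h1], h⟩
  -- For uniqueness, the property of `κ` is applied to the cokernel with the explicit numerator
  -- `a.laurent`. The series `K` it supplies must be the one computed from the resolution `R`.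
  · have hM := SigmaModel.represents_coker a
    obtain ⟨e, he, g₀, hg₀⟩ := hM.exists_hasRes hW
    obtain ⟨R, hR, hRe⟩ := he.exists_freeResolution
    obtain ⟨K, -, hK, -, h⟩ := hκ a _ hM
    have hK' : SigmaModel.formalSeries e = K := by rw [← hRe, hK R hR]
    refine AddMonoidAlgebra.ext (Finsupp.ext fun v => ?_)
    rw [(h _ _ (hK' ▸ hg₀) v).2, SigmaModel.kappa_cls, a.finsum_laurent_coeff]
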